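/- For $n\ge 1$ let $$M_n^{[0,1]}=\Big\{\Big(\int_0^1 x\,\mu(dx),\dots,\int_0^1 x^n\,\mu(dx)\Big):\ \mu\text{ a probability measure on }[0,1]\Big\}\subset\mathbb R^n ,$$ and call uniform distribution on $M_n^{[0,1]}$ the normalized Lebesgue measure on this set. For a measure $\gamma$ on $[0,1]$ let $m_k(\gamma)=\int x^k\,\gamma(dx)$. For $\beta,a,b>0$ and $N\ge 0$ let $J(\beta,a,b,N)$ be the probability distribution on $[0,1]^N$ with density proportional to $$\prod_{1\le i<j\le N}|x_j-x_i|^{\beta}\ \prod_{k=1}^N x_k^{b-1}(1-x_k)^{a-1}$$ (for $N=0$, the unit mass at the single point). For $a_1,\dots,a_n>0$ let $\operatorname{Dir}(a_1,\dots,a_n)$ be the probability distribution on the simplex $\{x_i>0,\ x_1+\dots+x_n=1\}$ with density $$\frac{\Gamma(a_1+\dots+a_n)}{\Gamma(a_1)\cdots\Gamma(a_n)}\,x_1^{a_1-1}\cdots x_n^{a_n-1}$$ with respect to Lebesgue measure $dx_1\cdots dx_{n-1}$ on the simplex (for $n=1$, the unit mass at $1$), and let $\operatorname{Dir}_n(a)=\operatorname{Dir}(a,\dots,a)$.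 Let $N\ge 1$. 1. If $(x_1,\dots,x_N,w_1,\dots,w_N)$ has distribution $J(4,1,1,N)\otimes\operatorname{Dir}_N(2)$ and $\gamma=\sum_{k=1}^N w_k\delta_{x_k}$, then $(m_1(\gamma),\dots,m_{2N-1}(\gamma))$ is uniformly distributed on $M_{2N-1}^{[0,1]}$. 2. If $(x_1,\dots,x_N,w_0,\dots,w_N)$ has distribution $J(4,1,3,N)\otimes\operatorname{Dir}(1,2,\dots,2)$ (first parameter $1$, the $N$ others $2$) and $\gamma=w_0\delta_0+\sum_{k=1}^N w_k\delta_{x_k}$, then $(m_1(\gamma),\dots,m_{2N}(\gamma))$ is uniformly distributed on $M_{2N}^{[0,1]}$. 3. If $(x_1,\dots,x_{N-1},w_0,\dots,w_N)$ has distribution $J(4,3,3,N-1)\otimes\operatorname{Dir}(1,2,\dots,2,1)$ (first and last parameters $1$, the $N-1$ others $2$) and $\gamma=w_0\delta_0+\sum_{k=1}^{N-1} w_k\delta_{x_k}+w_N\delta_1$, then $(m_1(\gamma),\dots,m_{2N-1}(\gamma))$ is uniformly distributed on $M_{2N-1}^{[0,1]}$. 4. If $(x_1,\dots,x_N,w_1,\dots,w_{N+1})$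 has distribution $J(4,3,1,N)\otimes\operatorname{Dir}(2,\dots,2,1)$ (last parameter $1$, the $N$ others $2$) and $\gamma=\sum_{k=1}^N w_k\delta_{x_k}+w_{N+1}\delta_1$, then $(m_1(\gamma),\dots,m_{2N}(\gamma))$ is uniformly distributed on $M_{2N}^{[0,1]}$. -/

import Mathlib

open MeasureTheory ProbabilityTheory
open scoped ENNReal

noncomputable section

namespace RandomMoments

/-- The vector `(m₁(γ), …, mₙ(γ))` of the first `n` moments of a measure on the real line
(coordinate `k : Fin n` is the moment of order `k + 1`). -/
def moments (n : ℕ) (γ : Measure ℝ) : Fin n → ℝ :=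
  fun k => ∫ x, x ^ ((k : ℕ) + 1) ∂γ

/-- The `n`-th moment space of `[0,1]`: the vectors of the first `n` moments of all
probability measures carried by `[0,1]`. -/
def momentSpace (n : ℕ) : Set (Fin n → ℝ) :=
  {m | ∃ μ : Measure ℝ, IsProbabilityMeasure μ ∧ μ (Set.Icc (0 : ℝ) 1)ᶜ = 0 ∧ m = moments n μ}

/-- The uniform distribution on the `n`-th moment space: normalized Lebesgue measure. -/
def uniformMoments (n : ℕ) : Measure (Fin n → ℝ) :=
  cond volume (momentSpace n)

/-- The Vandermonde product `Δ(x₁, …, x_N) = ∏_{i < j} (x_j - x_i)`. -/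
def vandermondeProd {N : ℕ} (x : Fin N → ℝ) : ℝ :=
  ∏ i : Fin N, ∏ j ∈ Finset.Ioi i, (x j - x i)

/-- The unnormalized density `|Δ(x)|^β ∏ x_k^(b-1) (1 - x_k)^(a-1)`. -/
def jacobiWeight (β a b : ℝ) {N : ℕ} (x : Fin N → ℝ) : ℝ :=
  |vandermondeProd x| ^ β * ∏ k : Fin N, (x k ^ (b - 1) * (1 - x k) ^ (a - 1))

/-- The measure on the cube `[0,1]^N` with Lebesgue density `jacobiWeight β a b`. -/
def jacobiUnnormalized (β a b : ℝ) (N : ℕ) : Measure (Fin N → ℝ) :=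
  (volume.restrict (Set.univ.pi fun _ : Fin N => Set.Icc (0 : ℝ) 1)).withDensity
    fun x => ENNReal.ofReal (jacobiWeight β a b x)

/-- The Jacobi distribution `J(β, a, b, N)`: the probability distribution on `[0,1]^N` whose
density is proportional to `jacobiWeight β a b`. -/
def jacobi (β a b : ℝ) (N : ℕ) : Measure (Fin N → ℝ) :=
  (jacobiUnnormalized β a b N Set.univ)⁻¹ • jacobiUnnormalized β a b N

/-- Lebesgue measure on the open simplex `{x : Fin n → ℝ | 0 < x i, ∑ x i = 1}`, parametrized by
all coordinates but the last one. The simplex is empty for `n = 0`. -/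
def simplexVolume : (n : ℕ) → Measure (Fin n → ℝ)
  | 0 => 0
  | k + 1 =>
    (volume.restrict {x : Fin k → ℝ | (∀ i, 0 < x i) ∧ ∑ i, x i < 1}).map
      fun x => Fin.snoc (α := fun _ => ℝ) x (1 - ∑ i, x i)

/-- The Dirichlet distribution `Dir(a₁, …, aₙ)` on the simplex. -/
def dirichlet {n : ℕ} (a : Fin n → ℝ) : Measure (Fin n → ℝ) :=
  (simplexVolume n).withDensity fun x =>
    ENNReal.ofReal (Real.Gamma (∑ i, a i) / (∏ i, Real.Gamma (a i)) * ∏ i, x i ^ (a i - 1))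

/-- The point mass of weight `w` at `x`. -/
def atom (w x : ℝ) : Measure ℝ :=
  ENNReal.ofReal w • Measure.dirac x

end RandomMoments

end

/-! All four laws are one change of variables. Take `N` free nodes `x` in `(0,1)`, a set `y` of
fixed nodes among the endpoints `0, 1`, and weights summing to one. If there are `k + 1` nodes in
total, the free parameters are `N` nodes and `k` weights, exactly as many as the moments of order
`1, …, N + k`.

The Jacobian of the map from parameters to moments is a confluent Vandermonde determinant:
differentiating in a free node gives a derivative column, differentiating in a weight gives a
difference of two evaluation columns. Free nodes are thus double and endpoints simple, and
`abs_det_jacobianMatrix` gives the absolute value `∏ w_l · |Δ(x)|^4 · ∏ |x_l - y_e|^2`, the weights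
being those of the free nodes. Up to a constant this is the Jacobi density with `β = 4` times the
Dirichlet density (`density_eq`): an endpoint carried as an atom contributes exponent `2`, hence
Jacobi parameter `3` instead of `1`, and Dirichlet parameter `1` instead of `2`.

On each ordering of the free nodes the map is a bijection onto the interior of the moment space.
Injectivity (`injOn_momentVector`) is Lagrange interpolation: two such measures together have at
most `2N + |E| = n + 1` nodes, where `n = N + k`. Surjectivity (`image_momentVector`) is a
connectedness argument: the image is open because the Jacobian does not vanish, and it is closed in
the interior because degenerate parameters go to the boundary, as certified by a polynomial of
degree at most `n` that is nonnegative on `[0,1]` and integrates to zero.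

Hence every ordering pushes the Jacobian density to Lebesgue measure on the moment space, and the
sum over orderings is a multiple of it. The multiple need not be computed, since the total mass is
one. -/

namespace RandomMoments

/-! ### Vandermonde determinants and products over pairs. -/

/-- The squared Vandermonde determinant as a product over ordered pairs of distinct indices. -/
theorem abs_det_vandermonde_sq {κ : Type*} [Fintype κ] [DecidableEq κ] {n : ℕ} (e : κ ≃ Fin n)
    (z : κ → ℝ) :
    |(Matrix.of fun a b : κ => z b ^ (e a : ℕ)).det| ^ 2
      = ∏ a, ∏ b ∈ {a}ᶜ, |z a - z b| := by
  have h1 : (Matrix.of fun a b : κ => z b ^ (e a : ℕ))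
      = ((Matrix.vandermonde (z ∘ e.symm)).transpose).submatrix e e := by
    ext a b
    simp [Matrix.vandermonde]
  rw [h1, Matrix.det_submatrix_equiv_self, Matrix.det_transpose, Matrix.det_vandermonde]
  rw [Finset.abs_prod, ← Finset.prod_pow]
  have h2 : ∀ i : Fin n, |∏ j ∈ Finset.Ioi i, ((z ∘ e.symm) j - (z ∘ e.symm) i)| ^ 2
      = ∏ j ∈ Finset.Ioi i, (|z (e.symm i) - z (e.symm j)| * |z (e.symm j) - z (e.symm i)|) := by
    intro i
    rw [Finset.abs_prod, ← Finset.prod_pow]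
    refine Finset.prod_congr rfl fun j _ => ?_
    rw [abs_sub_comm (z (e.symm i))]
    simp [sq]
  rw [Finset.prod_congr rfl fun i _ => h2 i,
    Finset.prod_prod_Ioi_mul_eq_prod_prod_off_diag
      (fun j i => |z (e.symm i) - z (e.symm j)|)]
  rw [← Equiv.prod_comp e]
  refine Finset.prod_congr rfl fun a _ => ?_
  refine Finset.prod_equiv e.symm ?_ ?_ <;> simp [Equiv.symm_apply_eq]

/-- Products over pairs of distinct elements of a disjoint union. -/
theorem prod_offDiag_sum {α β : Type*} [Fintype α] [Fintype β] [DecidableEq α] [DecidableEq β]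
    (g : α ⊕ β → α ⊕ β → ℝ) (hg : ∀ a b, g a b = g b a) :
    ∏ a, ∏ b ∈ {a}ᶜ, g a b
      = (∏ a : α, ∏ b ∈ {a}ᶜ, g (.inl a) (.inl b)) * (∏ a : β, ∏ b ∈ {a}ᶜ, g (.inr a) (.inr b))
        * ∏ a : α, ∏ b : β, g (.inl a) (.inr b) ^ 2 := by
  have hl : ∀ a : α, ∏ b ∈ {Sum.inl a}ᶜ, g (.inl a) b
      = (∏ b ∈ {a}ᶜ, g (.inl a) (.inl b)) * ∏ b : β, g (.inl a) (.inr b) := by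
    intro a
    have : ({Sum.inl a}ᶜ : Finset (α ⊕ β)) = Finset.disjSum {a}ᶜ Finset.univ := by
      ext x; cases x <;> simp
    rw [this, Finset.prod_disjSum]
  have hr : ∀ a : β, ∏ b ∈ {Sum.inr a}ᶜ, g (.inr a) b
      = (∏ b : α, g (.inr a) (.inl b)) * ∏ b ∈ {a}ᶜ, g (.inr a) (.inr b) := by
    intro a
    have : ({Sum.inr a}ᶜ : Finset (α ⊕ β)) = Finset.disjSum Finset.univ {a}ᶜ := by
      ext x; cases x <;> simp
    rw [this, Finset.prod_disjSum]
  rw [Fintype.prod_sum_type]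
  simp only [hl, hr, Finset.prod_mul_distrib, Finset.prod_pow]
  have : ∏ a : β, ∏ b : α, g (.inr a) (.inl b) = ∏ a : α, ∏ b : β, g (.inl a) (.inr b) := by
    rw [Finset.prod_comm]
    simp only [hg (.inr _) (.inl _)]
  rw [this]
  ring

/-! ### Confluent Vandermonde determinants as limits of ordinary ones. -/

section Confluent

variable {α β : Type*} [Fintype α] [Fintype β] [DecidableEq α] [DecidableEq β]

/-- The confluent Vandermonde matrix with its derivative columns replaced by divided differences
of step `h`. -/
def dividedVandermonde {n : ℕ} (e : α ⊕ (α ⊕ β) ≃ Fin n) (x v : α → ℝ) (y : β → ℝ) (h : ℝ) :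
    Matrix (α ⊕ (α ⊕ β)) (α ⊕ (α ⊕ β)) ℝ :=
  Matrix.of fun a b => Sum.elim
    (fun l => v l * ∑ i ∈ Finset.range (e a), (x l + h) ^ i * x l ^ ((e a : ℕ) - 1 - i))
    (fun i => Sum.elim x y i ^ (e a : ℕ)) b

theorem continuous_dividedVandermonde_det {n : ℕ} (e : α ⊕ (α ⊕ β) ≃ Fin n) (x v : α → ℝ)
    (y : β → ℝ) : Continuous fun h => (dividedVandermonde e x v y h).det := by
  refine Continuous.matrix_det ?_
  refine continuous_matrix fun a b => ?_
  rcases b with b | b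
  · simp only [dividedVandermonde, Matrix.of_apply, Sum.elim_inl]
    fun_prop
  · simp only [dividedVandermonde, Matrix.of_apply, Sum.elim_inr]
    fun_prop

/-- A divided-difference column is the column at `x l + h` minus the column at `x l`, scaled by `v l
/ h`. These column operations form a block triangular matrix whose determinant is the product of the
scalars. -/
theorem det_dividedVandermonde {n : ℕ} (e : α ⊕ (α ⊕ β) ≃ Fin n) (x v : α → ℝ)
    (y : β → ℝ) {h : ℝ} (hh : h ≠ 0) :
    (dividedVandermonde e x v y h).det
      = (Matrix.of fun a b : α ⊕ (α ⊕ β) =>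
          (Sum.elim (fun l => x l + h) (Sum.elim x y) b) ^ (e a : ℕ)).det * ∏ l, (v l / h) := by
  have hU : (Matrix.fromBlocks (Matrix.diagonal fun l => v l / h) 0
      (Matrix.of fun (i : α ⊕ β) (l : α) => if i = Sum.inl l then -(v l / h) else 0)
      (1 : Matrix (α ⊕ β) (α ⊕ β) ℝ)).det = ∏ l, (v l / h) := by
    rw [Matrix.det_fromBlocks_zero₁₂]; simp
  rw [← hU, ← Matrix.det_mul]
  congr 1
  ext a b
  rw [Matrix.mul_apply, Fintype.sum_sum_type]
  rcases b with l | i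
  · have := (Commute.all (x l + h) (x l)).geom_sum₂_mul (e a : ℕ)
    simp only [dividedVandermonde, Matrix.of_apply, Sum.elim_inl, Sum.elim_inr,
      Matrix.fromBlocks_apply₁₁, Matrix.fromBlocks_apply₂₁, Matrix.diagonal_apply]
    simp only [mul_ite, mul_zero, Finset.sum_ite_eq', Finset.mem_univ, if_true, Sum.elim_inl]
    rw [add_sub_cancel_left] at this
    field_simp
    linear_combination v l * this
  · simp [dividedVandermonde, Matrix.one_apply]

/-- The squared confluent Vandermonde determinant with double nodes `x`, simple nodes `y`, and
derivative columns scaled by `v`. -/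
theorem confluent_det_sq {n : ℕ} (e : α ⊕ (α ⊕ β) ≃ Fin n) (x v : α → ℝ) (y : β → ℝ) :
    |(Matrix.of fun a b : α ⊕ (α ⊕ β) => Sum.elim
      (fun l => v l * ((e a : ℕ) * x l ^ ((e a : ℕ) - 1)))
      (fun i => Sum.elim x y i ^ (e a : ℕ)) b).det| ^ 2
    = (∏ l, |v l|) ^ 2 * (∏ l, ∏ l' ∈ {l}ᶜ, |x l - x l'|) ^ 4
      * (∏ l, ∏ i, |x l - y i|) ^ 4 * ∏ i, ∏ i' ∈ {i}ᶜ, |y i - y i'| := by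
  have h0 : (Matrix.of fun a b : α ⊕ (α ⊕ β) => Sum.elim
      (fun l => v l * ((e a : ℕ) * x l ^ ((e a : ℕ) - 1)))
      (fun i => Sum.elim x y i ^ (e a : ℕ)) b) = dividedVandermonde e x v y 0 := by
    ext a b
    rcases b with l | i
    · simp only [dividedVandermonde, Matrix.of_apply, Sum.elim_inl, add_zero]
      rw [geom_sum₂_self]
    · simp [dividedVandermonde]
  rw [h0]
  set G : ℝ → ℝ := fun h => (∏ l, |v l|) ^ 2 * ((∏ l, ∏ l' ∈ {l}ᶜ, |x l - x l'|)
    * (∏ a, ∏ b ∈ {a}ᶜ, |Sum.elim x y a - Sum.elim x y b|)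
    * ∏ l, ∏ i ∈ {Sum.inl l}ᶜ, |x l + h - Sum.elim x y i| ^ 2) with hG
  have hGc : Continuous G := by
    simp only [hG]
    fun_prop
  have hlim := ((continuous_dividedVandermonde_det e x v y).abs.pow 2)
  have heq : ∀ h : ℝ, h ≠ 0 → |(dividedVandermonde e x v y h).det| ^ 2 = G h := by
    intro h hh
    rw [det_dividedVandermonde e x v y hh, abs_mul, mul_pow, abs_det_vandermonde_sq,
      prod_offDiag_sum _ (fun a b => abs_sub_comm _ _)]
    simp only [Sum.elim_inl, Sum.elim_inr, add_sub_add_right_eq_sub, hG]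
    -- The pair `x l + h`, `x l` contributes `h ^ 2`, which cancels the `1 / h` of the divided
    -- difference after squaring.
    have : ∀ l, ∏ i : α ⊕ β, |x l + h - Sum.elim x y i| ^ 2
        = h ^ 2 * ∏ i ∈ {Sum.inl l}ᶜ, |x l + h - Sum.elim x y i| ^ 2 := by
      intro l
      rw [← Finset.prod_mul_prod_compl {Sum.inl l}]
      simp
    simp only [this, Finset.prod_mul_distrib, Finset.abs_prod, abs_div, Finset.prod_div_distrib,
      Finset.prod_const]
    have hc : (h ^ 2) ^ (Finset.univ : Finset α).card ≠ 0 := by positivity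
    rw [div_pow, sq_abs (h ^ _), pow_right_comm h _ 2]
    field_simp
  -- Both sides are continuous in `h` and agree off `0`, so they agree at `0`, where divided
  -- differences become derivatives.
  have hext : (fun h => |(dividedVandermonde e x v y h).det| ^ 2) = G := by
    refine Continuous.ext_on (s := {(0 : ℝ)}ᶜ) (dense_compl_singleton 0) hlim hGc ?_
    intro h hh
    exact heq h hh
  rw [congrFun hext 0, hG]
  simp only [add_zero]
  rw [prod_offDiag_sum _ (fun a b => abs_sub_comm _ _)]
  have : ∀ l, ∏ i ∈ {Sum.inl l}ᶜ, |x l - Sum.elim x y i| ^ 2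
      = (∏ l' ∈ {l}ᶜ, |x l - x l'|) ^ 2 * (∏ i, |x l - y i|) ^ 2 := by
    intro l
    have : ({Sum.inl l}ᶜ : Finset (α ⊕ β)) = Finset.disjSum {l}ᶜ Finset.univ := by
      ext x; cases x <;> simp
    rw [this, Finset.prod_disjSum]
    simp only [Finset.prod_pow, Sum.elim_inl, Sum.elim_inr]
  simp only [this, Sum.elim_inl, Sum.elim_inr, Finset.prod_mul_distrib, Finset.prod_pow]
  ring

end Confluent

/-! ### The moment map in nodes and weights, and its Jacobian. -/

section Chart

variable {N k : ℕ} {E : Type*}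

/-- The weight vector on the simplex with all coordinates but the last one prescribed. -/
def fullWeights {k : ℕ} (w : Fin k → ℝ) : Fin (k + 1) → ℝ :=
  Fin.snoc (α := fun _ => ℝ) w (1 - ∑ i, w i)

/-- The order of the moment recorded in a coordinate of the chart. -/
def momentOrder (r : Fin N ⊕ Fin k) : ℕ := (finSumFinEquiv r : ℕ) + 1

/-- The moments of the measure with free nodes `z ∘ inl`, fixed nodes `y`, and weights determined
by `z ∘ inr`. -/
def momentChart [Fintype E] (t : Fin N ⊕ E ≃ Fin (k + 1)) (y : E → ℝ) (z : Fin N ⊕ Fin k → ℝ) :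
    Fin N ⊕ Fin k → ℝ :=
  fun r => ∑ i, fullWeights (z ∘ Sum.inr) (t i) * Sum.elim (z ∘ Sum.inl) y i ^ momentOrder r

/-- The Jacobian matrix of `momentChart`. -/
def jacobianMatrix (t : Fin N ⊕ E ≃ Fin (k + 1)) (y : E → ℝ) (z : Fin N ⊕ Fin k → ℝ) :
    Matrix (Fin N ⊕ Fin k) (Fin N ⊕ Fin k) ℝ :=
  Matrix.of fun r c => Sum.elim
    (fun l => fullWeights (z ∘ Sum.inr) (t (.inl l))
      * (momentOrder r * z (.inl l) ^ (momentOrder r - 1)))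
    (fun j => Sum.elim (z ∘ Sum.inl) y (t.symm j.castSucc) ^ momentOrder r
      - Sum.elim (z ∘ Sum.inl) y (t.symm (Fin.last k)) ^ momentOrder r) c

theorem sum_fullWeights (w : Fin k → ℝ) : ∑ i, fullWeights w i = 1 := by
  simp [fullWeights, Fin.sum_univ_castSucc]

theorem hasStrictFDerivAt_fullWeights (z : Fin N ⊕ Fin k → ℝ) (i : Fin (k + 1)) :
    HasStrictFDerivAt (fun z : Fin N ⊕ Fin k → ℝ => fullWeights (z ∘ Sum.inr) i)
      (Fin.snoc (α := fun _ => (Fin N ⊕ Fin k → ℝ) →L[ℝ] ℝ)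
        (fun j => ContinuousLinearMap.proj (Sum.inr j))
        (-∑ j, ContinuousLinearMap.proj (Sum.inr j)) i) z := by
  refine Fin.lastCases ?_ (fun j => ?_) i
  · simp only [fullWeights, Fin.snoc_last, Function.comp_apply]
    refine HasStrictFDerivAt.const_sub ?_ 1
    exact HasStrictFDerivAt.fun_sum fun j _ => hasStrictFDerivAt_apply _ _
  · simp only [fullWeights, Fin.snoc_castSucc, Function.comp_apply]
    exact hasStrictFDerivAt_apply _ _

theorem hasStrictFDerivAt_nodes (y : E → ℝ) (z : Fin N ⊕ Fin k → ℝ) (i : Fin N ⊕ E) :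
    HasStrictFDerivAt (fun z : Fin N ⊕ Fin k → ℝ => Sum.elim (z ∘ Sum.inl) y i)
      (Sum.elim (fun l => (ContinuousLinearMap.proj (Sum.inl l) : (Fin N ⊕ Fin k → ℝ) →L[ℝ] ℝ))
        (fun _ => 0) i) z := by
  rcases i with l | e
  · exact hasStrictFDerivAt_apply _ _
  · exact hasStrictFDerivAt_const _ _

theorem hasStrictFDerivAt_momentChart [Fintype E] (t : Fin N ⊕ E ≃ Fin (k + 1)) (y : E → ℝ)
    (z : Fin N ⊕ Fin k → ℝ) :
    HasStrictFDerivAt (momentChart t y)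
      (Matrix.toLin' (jacobianMatrix t y z)).toContinuousLinearMap z := by
  rw [hasStrictFDerivAt_pi']
  intro r
  have h := HasStrictFDerivAt.fun_sum (u := Finset.univ) fun i _ =>
    (hasStrictFDerivAt_fullWeights z (t i)).mul
      ((hasStrictFDerivAt_nodes y z i).pow (momentOrder r))
  refine h.congr_fderiv ?_
  ext v
  simp only [_root_.sum_apply, _root_.add_apply,
    _root_.smul_apply, smul_eq_mul, ContinuousLinearMap.comp_apply,
    ContinuousLinearMap.proj_apply, LinearMap.coe_toContinuousLinearMap', Matrix.toLin'_apply,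
    Matrix.mulVec, dotProduct, Finset.sum_add_distrib,
    Fintype.sum_sum_type (α₁ := Fin N) (α₂ := Fin k)]
  congr 1
  · simp [jacobianMatrix, Fintype.sum_sum_type, mul_assoc]
  · rw [← Equiv.sum_comp t.symm]
    simp [jacobianMatrix, Fin.sum_univ_castSucc, sub_mul, Finset.mul_sum,
      Finset.sum_sub_distrib, ← sub_eq_add_neg]

/-- The order of rows of the bordered Jacobian: the chart coordinates followed by order zero. -/
def borderedOrder (N k : ℕ) : (Fin N ⊕ Fin k) ⊕ Unit ≃ Fin (N + k + 1) :=
  (Equiv.sumCongr finSumFinEquiv (Equiv.refl Unit)).trans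
    ((Equiv.optionEquivSumPUnit (Fin (N + k))).symm.trans (finSuccEquiv (N + k)).symm)

theorem borderedOrder_inl (r : Fin N ⊕ Fin k) :
    (borderedOrder N k (.inl r) : ℕ) = momentOrder r := by
  simp [borderedOrder, momentOrder]

theorem borderedOrder_inr (u : Unit) : (borderedOrder N k (.inr u) : ℕ) = 0 := by
  simp [borderedOrder]

/-- The columns of the bordered Jacobian: one derivative column for each free node and one
evaluation column for each node. -/
def borderedColumn (t : Fin N ⊕ E ≃ Fin (k + 1)) :
    (Fin N ⊕ Fin k) ⊕ Unit ≃ Fin N ⊕ (Fin N ⊕ E) :=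
  (Equiv.sumAssoc (Fin N) (Fin k) Unit).trans
    (Equiv.sumCongr (Equiv.refl _)
      (((Equiv.optionEquivSumPUnit (Fin k)).symm.trans finSuccEquivLast.symm).trans t.symm))

theorem borderedColumn_deriv (t : Fin N ⊕ E ≃ Fin (k + 1)) (l : Fin N) :
    borderedColumn t (.inl (.inl l)) = .inl l := rfl

theorem borderedColumn_castSucc (t : Fin N ⊕ E ≃ Fin (k + 1)) (j : Fin k) :
    borderedColumn t (.inl (.inr j)) = .inr (t.symm j.castSucc) := by
  simp [borderedColumn]

theorem borderedColumn_last (t : Fin N ⊕ E ≃ Fin (k + 1)) (u : Unit) :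
    borderedColumn t (.inr u) = .inr (t.symm (Fin.last k)) := by
  simp [borderedColumn]

/-- The last weight is determined by the others, so the last evaluation column is subtracted from
the other evaluation columns. Bordering by that column and by a row of order zero (`0` under
derivatives, `1` under evaluations) undoes the subtraction: the Jacobian is the Schur complement of
the corner entry `1` in a full confluent Vandermonde matrix. -/
theorem det_jacobianMatrix [Fintype E] [DecidableEq E] (t : Fin N ⊕ E ≃ Fin (k + 1)) (y : E → ℝ)
    (z : Fin N ⊕ Fin k → ℝ) :
    (jacobianMatrix t y z).det = (Matrix.of fun a b : Fin N ⊕ (Fin N ⊕ E) => Sum.elim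
      (fun l => fullWeights (z ∘ Sum.inr) (t (.inl l)) *
        ((((borderedColumn t).symm.trans (borderedOrder N k)) a : ℕ) *
          (z ∘ Sum.inl) l ^ ((((borderedColumn t).symm.trans (borderedOrder N k)) a : ℕ) - 1)))
      (fun i => Sum.elim (z ∘ Sum.inl) y i ^
        (((borderedColumn t).symm.trans (borderedOrder N k)) a : ℕ)) b).det := by
  rw [← Matrix.det_submatrix_equiv_self (borderedColumn t)]
  set x := z ∘ Sum.inl
  set W := fullWeights (z ∘ Sum.inr)
  have := Matrix.det_fromBlocks_one₂₂
    (Matrix.of fun (r c : Fin N ⊕ Fin k) => Sum.elim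
      (fun l => W (t (.inl l)) * (momentOrder r * x l ^ (momentOrder r - 1)))
      (fun j => Sum.elim x y (t.symm j.castSucc) ^ momentOrder r) c)
    (Matrix.of fun (r : Fin N ⊕ Fin k) (_ : Unit) =>
      Sum.elim x y (t.symm (Fin.last k)) ^ momentOrder r)
    (Matrix.of fun (_ : Unit) (c : Fin N ⊕ Fin k) => Sum.elim (fun _ => (0 : ℝ)) (fun _ => 1) c)
  have h2 : jacobianMatrix t y z = (Matrix.of fun (r c : Fin N ⊕ Fin k) => Sum.elim
      (fun l => W (t (.inl l)) * (momentOrder r * x l ^ (momentOrder r - 1)))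
      (fun j => Sum.elim x y (t.symm j.castSucc) ^ momentOrder r) c) -
    (Matrix.of fun (r : Fin N ⊕ Fin k) (_ : Unit) =>
      Sum.elim x y (t.symm (Fin.last k)) ^ momentOrder r) *
    (Matrix.of fun (_ : Unit) (c : Fin N ⊕ Fin k) =>
      Sum.elim (fun _ => (0 : ℝ)) (fun _ => 1) c) := by
    ext r c
    rcases c with l | j <;> simp [jacobianMatrix, x, W, Matrix.mul_apply]
  rw [h2, ← this]
  congr 1
  ext a b
  rcases a with a | a <;> rcases b with (b | b) | b <;>
    simp only [Matrix.submatrix_apply, Matrix.of_apply, Equiv.trans_apply,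
      Equiv.symm_apply_apply, borderedOrder_inl, borderedOrder_inr] <;>
    simp [borderedColumn_deriv, borderedColumn_castSucc, borderedColumn_last]

theorem abs_det_jacobianMatrix [Fintype E] [DecidableEq E] (t : Fin N ⊕ E ≃ Fin (k + 1)) (y : E → ℝ)
    (hy : ∏ i, ∏ i' ∈ {i}ᶜ, |y i - y i'| = 1) (z : Fin N ⊕ Fin k → ℝ) :
    |(jacobianMatrix t y z).det|
      = (∏ l, |fullWeights (z ∘ Sum.inr) (t (.inl l))|) * |vandermondeProd (z ∘ Sum.inl)| ^ 4
        * ∏ l, ∏ i, |z (.inl l) - y i| ^ 2 := by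
  rw [det_jacobianMatrix]
  -- Only the absolute value matters, so squares are compared and the signs of row and column
  -- reorderings never appear.
  refine (pow_left_inj₀ (abs_nonneg _) (by positivity) two_ne_zero).1 ?_
  rw [confluent_det_sq, hy]
  have hV : ∏ l, ∏ l' ∈ {l}ᶜ, |(z ∘ Sum.inl) l - (z ∘ Sum.inl) l'|
      = |vandermondeProd (z ∘ Sum.inl)| ^ 2 := by
    rw [vandermondeProd, ← Finset.prod_prod_Ioi_mul_eq_prod_prod_off_diag
      (fun j i : Fin N => |(z ∘ Sum.inl) i - (z ∘ Sum.inl) j|)]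
    simp only [Finset.abs_prod, ← Finset.prod_pow]
    refine Finset.prod_congr rfl fun i _ => Finset.prod_congr rfl fun j _ => ?_
    rw [abs_sub_comm ((z ∘ Sum.inl) i), sq]
  rw [hV]
  simp only [Finset.prod_pow, Function.comp_apply]
  ring

end Chart

/-! ### Convexity of the moment space and its supporting polynomials. -/

section MomentSpace

open Polynomial

theorem integrable_of_unitInterval {μ : Measure ℝ} [IsFiniteMeasure μ]
    (h : μ (Set.Icc (0 : ℝ) 1)ᶜ = 0) {f : ℝ → ℝ} (hf : Continuous f) : Integrable f μ := by
  rw [← Measure.restrict_eq_self_of_ae_mem (s := Set.Icc (0 : ℝ) 1) (μ := μ) h]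
  exact hf.continuousOn.integrableOn_compact isCompact_Icc

/-- Mixtures of measures mix their moments. Convexity serves twice: the interior is connected, and
the frontier is Lebesgue null. -/
theorem convex_momentSpace (n : ℕ) : Convex ℝ (momentSpace n) := by
  rintro _ ⟨μ, hμ, hμ0, rfl⟩ _ ⟨ν, hν, hν0, rfl⟩ a b ha hb hab
  refine ⟨ENNReal.ofReal a • μ + ENNReal.ofReal b • ν, ⟨?_⟩, ?_, ?_⟩
  · simp [← ENNReal.ofReal_add ha hb, hab]
  · simp [hμ0, hν0]
  · ext r
    have hc : Continuous fun x : ℝ => x ^ ((r : ℕ) + 1) := by fun_prop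
    simp only [moments, Pi.add_apply, Pi.smul_apply, smul_eq_mul]
    rw [integral_add_measure ((integrable_of_unitInterval hμ0 hc).smul_measure ENNReal.ofReal_ne_top)
      ((integrable_of_unitInterval hν0 hc).smul_measure ENNReal.ofReal_ne_top),
      integral_smul_measure, integral_smul_measure]
    simp [ENNReal.toReal_ofReal, ha, hb]

/-- The integral of a polynomial of degree at most `n` in terms of the first `n` moments. -/
def momentFunctional {n : ℕ} (p : ℝ[X]) (m : Fin n → ℝ) : ℝ :=
  p.coeff 0 + ∑ r : Fin n, p.coeff (r + 1) * m r

theorem eval_eq_coeff_zero_add {n : ℕ} {p : ℝ[X]} (hp : p.natDegree ≤ n) (x : ℝ) :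
    p.eval x = p.coeff 0 + ∑ r : Fin n, p.coeff (r + 1) * x ^ ((r : ℕ) + 1) := by
  rw [eval_eq_sum_range' (Nat.lt_succ_of_le hp), Finset.sum_range_succ', Finset.sum_range, add_comm]
  simp

theorem momentFunctional_moments {n : ℕ} {p : ℝ[X]} (hp : p.natDegree ≤ n) {μ : Measure ℝ}
    [IsProbabilityMeasure μ] (h : μ (Set.Icc (0 : ℝ) 1)ᶜ = 0) :
    momentFunctional p (moments n μ) = ∫ x, p.eval x ∂μ := by
  simp only [eval_eq_coeff_zero_add hp, momentFunctional, moments]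
  rw [integral_add (integrable_const _) (integrable_of_unitInterval h (by fun_prop)),
    integral_finsetSum _ fun r _ => integrable_of_unitInterval h (by fun_prop)]
  simp [integral_const_mul]

theorem momentFunctional_nonneg {n : ℕ} {p : ℝ[X]} (hp : p.natDegree ≤ n)
    (h0 : ∀ x ∈ Set.Icc (0 : ℝ) 1, 0 ≤ p.eval x) {m : Fin n → ℝ} (hm : m ∈ momentSpace n) :
    0 ≤ momentFunctional p m := by
  obtain ⟨μ, hμ, hμ0, rfl⟩ := hm
  rw [momentFunctional_moments hp hμ0]
  refine integral_nonneg_of_ae ?_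
  have : ∀ᵐ x ∂μ, x ∈ Set.Icc (0 : ℝ) 1 := hμ0
  filter_upwards [this] with x hx using h0 x hx

theorem momentFunctional_sum {n : ℕ} {p : ℝ[X]} (hp : p.natDegree ≤ n) {ι : Type*} [Fintype ι]
    (W a : ι → ℝ) (hW : ∑ i, W i = 1) :
    momentFunctional p (fun r : Fin n => ∑ i, W i * a i ^ ((r : ℕ) + 1))
      = ∑ i, W i * p.eval (a i) := by
  simp only [eval_eq_coeff_zero_add hp, momentFunctional, mul_add, Finset.sum_add_distrib,
    ← Finset.sum_mul, hW, one_mul, Finset.mul_sum]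
  rw [Finset.sum_comm]
  congr 1
  refine Finset.sum_congr rfl fun i _ => Finset.sum_congr rfl fun r _ => by ring

/-- A supporting polynomial exhibits a boundary point of the moment space. -/
theorem notMem_interior_momentSpace {n : ℕ} {p : ℝ[X]} (hp0 : p ≠ 0) (hp : p.natDegree ≤ n)
    (h0 : ∀ x ∈ Set.Icc (0 : ℝ) 1, 0 ≤ p.eval x) {m : Fin n → ℝ}
    (hm : momentFunctional p m = 0) : m ∉ interior (momentSpace n) := by
  intro hint
  -- At an interior point a small step against the coefficient vector stays in the space but lowers
  -- the functional by `ε * ∑ r, c r ^ 2`. Nonnegativity then kills every coefficient.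
  set c : Fin n → ℝ := fun r => p.coeff (r + 1) with hc
  have hcont : Continuous fun ε : ℝ => m - ε • c := by fun_prop
  have hev : ∀ᶠ ε in nhds (0 : ℝ), m - ε • c ∈ momentSpace n := by
    refine hcont.continuousAt.eventually_mem ?_
    simpa using mem_interior_iff_mem_nhds.1 hint
  obtain ⟨ε, hε, hεpos⟩ := ((hev.filter_mono nhdsWithin_le_nhds).and
    (self_mem_nhdsWithin : Set.Ioi (0 : ℝ) ∈ nhdsWithin 0 (Set.Ioi 0))).exists
  have h1 := momentFunctional_nonneg hp h0 hε
  have h2 : momentFunctional p (m - ε • c) = momentFunctional p m - ε * ∑ r, c r ^ 2 := by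
    simp only [momentFunctional, Pi.sub_apply, Pi.smul_apply, smul_eq_mul, mul_sub,
      Finset.sum_sub_distrib, Finset.mul_sum, ← add_sub_assoc]
    congr 1
    refine Finset.sum_congr rfl fun r _ => by simp only [hc]; ring
  rw [h2, hm, zero_sub] at h1
  have h3 : ∑ r, c r ^ 2 = 0 := by
    have hs : 0 ≤ ∑ r, c r ^ 2 := Finset.sum_nonneg fun r _ => sq_nonneg _
    have hε' : (0 : ℝ) < ε := hεpos
    nlinarith
  have h4 : ∀ r, c r = 0 := by
    intro r
    have := (Finset.sum_eq_zero_iff_of_nonneg fun r _ => sq_nonneg (c r)).1 h3 r (Finset.mem_univ r)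
    simpa using this
  have h5 : p.coeff 0 = 0 := by
    have : ∑ r : Fin n, p.coeff (r + 1) * m r = 0 :=
      Finset.sum_eq_zero fun r _ => by rw [show p.coeff (r + 1) = 0 from h4 r, zero_mul]
    rwa [momentFunctional, this, add_zero] at hm
  refine hp0 (Polynomial.ext fun d => ?_)
  rcases d with _ | d
  · simpa using h5
  · by_cases hd : d < n
    · simpa using h4 ⟨d, hd⟩
    · simpa using coeff_eq_zero_of_natDegree_lt (by omega)

/-- The positive part reflects the truncation of negative weights in `atom`; it makes the formula
valid for all real weights. -/
theorem moments_sum_atom {n : ℕ} {ι : Type*} [Fintype ι] (W a : ι → ℝ) :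
    moments n (∑ i, atom (W i) (a i)) = fun r : Fin n => ∑ i, max (W i) 0 * a i ^ ((r : ℕ) + 1) := by
  ext r
  simp only [moments, atom]
  rw [integral_finsetSum_measure fun i _ =>
    (integrable_dirac (by simp)).smul_measure ENNReal.ofReal_ne_top]
  simp [integral_smul_measure, ENNReal.toReal_ofReal']

theorem sum_mem_momentSpace {n : ℕ} {ι : Type*} [Fintype ι] {W a : ι → ℝ} (hW : ∀ i, 0 ≤ W i)
    (hW1 : ∑ i, W i = 1) (ha : ∀ i, a i ∈ Set.Icc (0 : ℝ) 1) :
    (fun r : Fin n => ∑ i, W i * a i ^ ((r : ℕ) + 1)) ∈ momentSpace n := by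
  refine ⟨∑ i, atom (W i) (a i), ⟨?_⟩, ?_, ?_⟩
  · simp [atom, ← ENNReal.ofReal_sum_of_nonneg fun i _ => hW i, hW1]
  · simp only [atom, Measure.coe_finsetSum, Finset.sum_apply, Measure.smul_apply, smul_eq_mul]
    refine Finset.sum_eq_zero fun i _ => ?_
    rw [Measure.dirac_apply' _ measurableSet_Icc.compl]
    simp only [Set.indicator_apply, Set.mem_compl_iff, ha i, not_true_eq_false, if_false, mul_zero]
  · rw [moments_sum_atom]
    simp [hW]

end MomentSpace

/-! ### Each ordered chart is a bijection onto the interior of the moment space. -/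

section Image

open Polynomial

variable {N k : ℕ} {E : Type*}

/-- `momentChart` with its coordinates in the order of the moments. -/
def momentVector [Fintype E] (t : Fin N ⊕ E ≃ Fin (k + 1)) (y : E → ℝ) (z : Fin N ⊕ Fin k → ℝ) :
    Fin (N + k) → ℝ :=
  fun r => ∑ i, fullWeights (z ∘ Sum.inr) (t i) * Sum.elim (z ∘ Sum.inl) y i ^ ((r : ℕ) + 1)

/-- The parameters with free nodes in the open interval, ordered by `σ`, and positive weights. -/
def chartDomain (N k : ℕ) (σ : Equiv.Perm (Fin N)) : Set (Fin N ⊕ Fin k → ℝ) :=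
  {z | (∀ l, z (.inl l) ∈ Set.Ioo (0 : ℝ) 1) ∧ StrictMono (fun l => z (.inl (σ l))) ∧
    ∀ i, 0 < fullWeights (z ∘ Sum.inr) i}

/-- The closed counterpart of `chartDomain`. -/
def closedChartDomain (N k : ℕ) (σ : Equiv.Perm (Fin N)) : Set (Fin N ⊕ Fin k → ℝ) :=
  {z | (∀ l, z (.inl l) ∈ Set.Icc (0 : ℝ) 1) ∧ Monotone (fun l => z (.inl (σ l))) ∧
    ∀ i, 0 ≤ fullWeights (z ∘ Sum.inr) i}

theorem continuous_fullWeights (i : Fin (k + 1)) :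
    Continuous fun z : Fin N ⊕ Fin k → ℝ => fullWeights (z ∘ Sum.inr) i :=
  continuous_iff_continuousAt.2 fun z => (hasStrictFDerivAt_fullWeights z i).continuousAt

theorem continuous_nodes (y : E → ℝ) (i : Fin N ⊕ E) :
    Continuous fun z : Fin N ⊕ Fin k → ℝ => Sum.elim (z ∘ Sum.inl) y i :=
  continuous_iff_continuousAt.2 fun z => (hasStrictFDerivAt_nodes y z i).continuousAt

theorem continuous_momentVector [Fintype E] (t : Fin N ⊕ E ≃ Fin (k + 1)) (y : E → ℝ) :
    Continuous (momentVector t y) :=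
  continuous_pi fun _ => continuous_finsetSum _ fun i _ =>
    (continuous_fullWeights (t i)).mul ((continuous_nodes y i).pow _)

theorem sum_fullWeights_comp [Fintype E] (t : Fin N ⊕ E ≃ Fin (k + 1)) (w : Fin k → ℝ) :
    ∑ i, fullWeights w (t i) = 1 := by
  rw [Equiv.sum_comp t, sum_fullWeights]

theorem isOpen_chartDomain (σ : Equiv.Perm (Fin N)) : IsOpen (chartDomain N k σ) := by
  simp only [chartDomain, StrictMono, Set.ofPred_and, Set.ofPred_forall, Set.mem_Ioo]
  refine IsOpen.inter ?_ (IsOpen.inter ?_ ?_)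
  · exact isOpen_iInter_of_finite fun l => (isOpen_lt continuous_const (continuous_apply _)).inter
      (isOpen_lt (continuous_apply _) continuous_const)
  · exact isOpen_iInter_of_finite fun i => isOpen_iInter_of_finite fun j =>
      isOpen_iInter_of_finite fun _ => isOpen_lt (continuous_apply _) (continuous_apply _)
  · exact isOpen_iInter_of_finite fun i => isOpen_lt continuous_const (continuous_fullWeights i)

theorem isCompact_closedChartDomain (σ : Equiv.Perm (Fin N)) :
    IsCompact (closedChartDomain N k σ) := by
  refine (isCompact_Icc (a := (0 : Fin N ⊕ Fin k → ℝ)) (b := 1)).of_isClosed_subset ?_ ?_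
  · simp only [closedChartDomain, Monotone, Set.ofPred_and, Set.ofPred_forall, Set.mem_Icc]
    refine IsClosed.inter ?_ (IsClosed.inter ?_ ?_)
    · exact isClosed_iInter fun l => (isClosed_le continuous_const (continuous_apply _)).inter
        (isClosed_le (continuous_apply _) continuous_const)
    · exact isClosed_iInter fun i => isClosed_iInter fun j =>
        isClosed_iInter fun _ => isClosed_le (continuous_apply _) (continuous_apply _)
    · exact isClosed_iInter fun i => isClosed_le continuous_const (continuous_fullWeights i)
  · rintro z ⟨hx, -, hW⟩
    have hle : ∀ i, fullWeights (z ∘ Sum.inr) i ≤ 1 := fun i =>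
      (sum_fullWeights (z ∘ Sum.inr)) ▸ Finset.single_le_sum (fun i _ => hW i) (Finset.mem_univ i)
    have hw : ∀ j, z (.inr j) = fullWeights (z ∘ Sum.inr) j.castSucc := fun j => by
      simp [fullWeights]
    constructor
    · rintro (l | j)
      · exact (hx l).1
      · rw [hw]; exact hW _
    · rintro (l | j)
      · exact (hx l).2
      · rw [hw]; exact hle _

theorem chartDomain_subset_closed (σ : Equiv.Perm (Fin N)) :
    chartDomain N k σ ⊆ closedChartDomain N k σ :=
  fun _ hz => ⟨fun l => Set.Ioo_subset_Icc_self (hz.1 l), hz.2.1.monotone, fun i => (hz.2.2 i).le⟩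

theorem chartDomain_nonempty (σ : Equiv.Perm (Fin N)) : (chartDomain N k σ).Nonempty := by
  refine ⟨Sum.elim (fun l => ((σ.symm l : ℕ) + 1 : ℝ) / (N + 1)) (fun _ => 1 / (k + 1 : ℝ)),
    fun l => ⟨?_, ?_⟩, ?_, ?_⟩
  · simp only [Sum.elim_inl]; positivity
  · simp only [Sum.elim_inl]
    rw [div_lt_one (by positivity)]
    have := (σ.symm l).isLt
    have h : ((σ.symm l : ℕ) : ℝ) < N := by exact_mod_cast this
    linarith
  · intro i j hij
    have h : ((i : ℕ) : ℝ) < (j : ℕ) := by exact_mod_cast hij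
    simp only [Sum.elim_inl, Equiv.symm_apply_apply]
    gcongr
  · intro i
    refine Fin.lastCases ?_ (fun j => ?_) i
    · simp only [fullWeights, Fin.snoc_last, Function.comp_apply, Sum.elim_inr, Finset.sum_const,
        Finset.card_univ, Fintype.card_fin, nsmul_eq_mul]
      rw [mul_one_div, sub_pos, div_lt_one (by positivity)]
      linarith
    · simp only [fullWeights, Fin.snoc_castSucc, Function.comp_apply, Sum.elim_inr]
      positivity

theorem card_add_card [Fintype E] (t : Fin N ⊕ E ≃ Fin (k + 1)) : N + Fintype.card E = k + 1 := by
  simpa using Fintype.card_congr t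

theorem momentVector_mem_momentSpace [Fintype E] (t : Fin N ⊕ E ≃ Fin (k + 1)) {y : E → ℝ}
    (hy : ∀ e, y e = 0 ∨ y e = 1) {σ : Equiv.Perm (Fin N)} {z : Fin N ⊕ Fin k → ℝ}
    (hz : z ∈ closedChartDomain N k σ) : momentVector t y z ∈ momentSpace (N + k) := by
  refine sum_mem_momentSpace (fun i => hz.2.2 _) (sum_fullWeights_comp t _) ?_
  rintro (l | e)
  · exact hz.1 l
  · rcases hy e with h | h <;> simp [h]

/-- The equality of the masses at every point of two atomic measures with the same moments. -/
theorem mass_eq_of_moments_eq {ι : Type*} [Fintype ι] {n : ℕ} {W W' a a' : ι → ℝ}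
    (hW : ∑ i, W i = 1) (hW' : ∑ i, W' i = 1) {T : Finset ℝ} (hT : T.card ≤ n + 1)
    (ha : ∀ i, a i ∈ T) (ha' : ∀ i, a' i ∈ T)
    (h : (fun r : Fin n => ∑ i, W i * a i ^ ((r : ℕ) + 1))
      = fun r : Fin n => ∑ i, W' i * a' i ^ ((r : ℕ) + 1)) {u : ℝ} (hu : u ∈ T) :
    ∑ i, (if a i = u then W i else 0) = ∑ i, (if a' i = u then W' i else 0) := by
  have hinj : Set.InjOn id (T : Set ℝ) := Function.injective_id.injOn
  -- This polynomial is `1` at `u` and `0` at the other points of `T`. Its degree `T.card - 1` is at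
  -- most `n`, so its integral, the mass at `u`, is determined by the moments.
  have hdeg : (Lagrange.basis T id u).natDegree ≤ n := by
    rw [natDegree_eq_of_degree_eq_some (Lagrange.degree_basis hinj hu)]
    omega
  have heval : ∀ b ∈ T, (Lagrange.basis T id u).eval b = if b = u then 1 else 0 := by
    intro b hb
    split_ifs with hbu
    · subst hbu; exact Lagrange.eval_basis_self hinj hb
    · exact Lagrange.eval_basis_of_ne (v := id) (Ne.symm hbu) hb
  have := congrArg (momentFunctional (Lagrange.basis T id u)) h
  rw [momentFunctional_sum hdeg _ _ hW, momentFunctional_sum hdeg _ _ hW'] at this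
  simpa [heval _ (ha _), heval _ (ha' _)] using this

theorem nodes_injective {y : E → ℝ} (hyi : Function.Injective y) (hy : ∀ e, y e = 0 ∨ y e = 1)
    {σ : Equiv.Perm (Fin N)} {z : Fin N ⊕ Fin k → ℝ} (hz : z ∈ chartDomain N k σ) :
    Function.Injective (Sum.elim (z ∘ Sum.inl) y) := by
  refine Function.Injective.sumElim ?_ hyi ?_
  · have := hz.2.1.injective.comp σ.symm.injective
    refine fun i j hij => this ?_
    simpa using hij
  · intro l e h
    have := hz.1 l
    rcases hy e with h' | h' <;> simp only [Function.comp_apply] at h <;>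
      rw [h, h'] at this <;> simp at this

/-- A free node carries positive mass, so it is a node of the other measure as well; lying strictly
inside `(0,1)`, it cannot be one of the fixed endpoints. -/
theorem range_subset_of_momentVector_eq [Fintype E] (t : Fin N ⊕ E ≃ Fin (k + 1)) {y : E → ℝ}
    (hy : ∀ e, y e = 0 ∨ y e = 1) {σ : Equiv.Perm (Fin N)}
    {z z' : Fin N ⊕ Fin k → ℝ} (hz : z ∈ chartDomain N k σ)
    (h : ∀ u, ∑ i, (if Sum.elim (z ∘ Sum.inl) y i = u
        then fullWeights (z ∘ Sum.inr) (t i) else 0)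
      = ∑ i, (if Sum.elim (z' ∘ Sum.inl) y i = u
        then fullWeights (z' ∘ Sum.inr) (t i) else 0)) :
    Set.range (fun l => z (.inl (σ l))) ⊆ Set.range (fun l => z' (.inl (σ l))) := by
  rintro _ ⟨l, rfl⟩
  have h1 := h (z (.inl (σ l)))
  have h2 : 0 < ∑ i, (if Sum.elim (z ∘ Sum.inl) y i = z (.inl (σ l))
      then fullWeights (z ∘ Sum.inr) (t i) else 0) := by
    refine Finset.sum_pos' (fun i _ => ?_) ⟨Sum.inl (σ l), Finset.mem_univ _, ?_⟩
    · split_ifs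
      · exact (hz.2.2 _).le
      · exact le_rfl
    · simpa using hz.2.2 _
  rw [h1] at h2
  obtain ⟨i, -, hi⟩ := Finset.exists_ne_zero_of_sum_ne_zero h2.ne'
  have hi' : Sum.elim (z' ∘ Sum.inl) y i = z (.inl (σ l)) := by
    by_contra hne
    exact hi (if_neg hne)
  rcases i with l' | e
  · exact ⟨σ.symm l', by simpa using hi'⟩
  · exfalso
    have := hz.1 (σ l)
    rw [← hi'] at this
    rcases hy e with h' | h' <;> simp [h'] at this

/-- Equal masses at every point give equal sets of free nodes. The common ordering `σ` identifies
the nodes themselves, and distinctness then identifies the weights. -/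
theorem injOn_momentVector [Fintype E] (t : Fin N ⊕ E ≃ Fin (k + 1)) {y : E → ℝ}
    (hyi : Function.Injective y) (hy : ∀ e, y e = 0 ∨ y e = 1) (σ : Equiv.Perm (Fin N)) :
    Set.InjOn (momentVector t y) (chartDomain N k σ) := by
  classical
  intro z hz z' hz' hzz
  set T : Finset ℝ := Finset.univ.image (z ∘ Sum.inl) ∪ Finset.univ.image (z' ∘ Sum.inl)
    ∪ Finset.univ.image y with hT
  have hTc : T.card ≤ N + k + 1 := by
    rw [hT]
    have h1 := Finset.card_union_le
      (Finset.univ.image (z ∘ Sum.inl) ∪ Finset.univ.image (z' ∘ Sum.inl)) (Finset.univ.image y)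
    have h2 := Finset.card_union_le (Finset.univ.image (z ∘ Sum.inl))
      (Finset.univ.image (z' ∘ Sum.inl))
    have h3 : (Finset.univ.image (z ∘ Sum.inl)).card ≤ N := by
      simpa using Finset.card_image_le (s := Finset.univ) (f := z ∘ Sum.inl)
    have h4 : (Finset.univ.image (z' ∘ Sum.inl)).card ≤ N := by
      simpa using Finset.card_image_le (s := Finset.univ) (f := z' ∘ Sum.inl)
    have h5 : (Finset.univ.image y).card ≤ Fintype.card E := Finset.card_image_le
    have h6 := card_add_card t
    omega
  have haT : ∀ i, Sum.elim (z ∘ Sum.inl) y i ∈ T := by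
    rintro (l | e) <;> simp [hT]
  have haT' : ∀ i, Sum.elim (z' ∘ Sum.inl) y i ∈ T := by
    rintro (l | e) <;> simp [hT]
  have hmass : ∀ u, ∑ i, (if Sum.elim (z ∘ Sum.inl) y i = u
        then fullWeights (z ∘ Sum.inr) (t i) else 0)
      = ∑ i, (if Sum.elim (z' ∘ Sum.inl) y i = u
        then fullWeights (z' ∘ Sum.inr) (t i) else 0) := by
    intro u
    by_cases hu : u ∈ T
    · exact mass_eq_of_moments_eq (sum_fullWeights_comp t _) (sum_fullWeights_comp t _) hTc
        haT haT' hzz hu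
    · rw [Finset.sum_eq_zero, Finset.sum_eq_zero]
      · exact fun i _ => if_neg fun h => hu (by rw [← h]; exact haT' i)
      · exact fun i _ => if_neg fun h => hu (by rw [← h]; exact haT i)
  have hrange : Set.range (fun l => z (.inl (σ l))) = Set.range (fun l => z' (.inl (σ l))) :=
    (range_subset_of_momentVector_eq t hy hz hmass).antisymm
      (range_subset_of_momentVector_eq t hy hz' fun u => (hmass u).symm)
  have hx0 := (hz.2.1.range_inj hz'.2.1).1 hrange
  have hx : z ∘ Sum.inl = z' ∘ Sum.inl := by
    ext l
    simpa using congrFun hx0 (σ.symm l)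
  have hW : ∀ i, fullWeights (z ∘ Sum.inr) (t i) = fullWeights (z' ∘ Sum.inr) (t i) := by
    intro i
    have h1 := hmass (Sum.elim (z ∘ Sum.inl) y i)
    rw [← hx] at h1
    simpa [(nodes_injective hyi hy hz).eq_iff] using h1
  ext c
  rcases c with l | j
  · exact congrFun hx l
  · simpa [fullWeights] using hW (t.symm j.castSucc)

/-- A polynomial of minimal degree that is nonnegative on `[0,1]` and vanishes at a node: of degree
two for a free node, of degree one for an endpoint. -/
noncomputable def nodeFactor (x : Fin N → ℝ) (y : E → ℝ) : Fin N ⊕ E → ℝ[X] :=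
  Sum.elim (fun l => (X - C (x l)) ^ 2) (fun e => if y e = 0 then X else 1 - X)

theorem natDegree_one_sub_X : (1 - X : ℝ[X]).natDegree = 1 := by
  rw [← natDegree_neg, neg_sub, ← C_1, natDegree_X_sub_C]

theorem one_sub_X_ne_zero : (1 - X : ℝ[X]) ≠ 0 :=
  ne_zero_of_natDegree_gt (n := 0) (by rw [natDegree_one_sub_X]; exact one_pos)

theorem natDegree_nodeFactor (x : Fin N → ℝ) (y : E → ℝ) (i : Fin N ⊕ E) :
    (nodeFactor x y i).natDegree = Sum.elim (fun _ => 2) (fun _ => 1) i := by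
  rcases i with l | e
  · simp [nodeFactor, natDegree_pow]
  · simp only [nodeFactor, Sum.elim_inr]
    split_ifs
    · exact natDegree_X
    · exact natDegree_one_sub_X

theorem nodeFactor_ne_zero (x : Fin N → ℝ) (y : E → ℝ) (i : Fin N ⊕ E) : nodeFactor x y i ≠ 0 := by
  refine ne_zero_of_natDegree_gt (n := 0) ?_
  rw [natDegree_nodeFactor]
  rcases i with l | e <;> simp

theorem nodeFactor_nonneg (x : Fin N → ℝ) (y : E → ℝ) (i : Fin N ⊕ E) {u : ℝ}
    (hu : u ∈ Set.Icc (0 : ℝ) 1) : 0 ≤ (nodeFactor x y i).eval u := by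
  rcases i with l | e
  · simp only [nodeFactor, Sum.elim_inl, eval_pow]; positivity
  · simp only [nodeFactor, Sum.elim_inr]
    split_ifs
    · simpa using hu.1
    · simpa using hu.2

theorem nodeFactor_eval_self (x : Fin N → ℝ) {y : E → ℝ} (hy : ∀ e, y e = 0 ∨ y e = 1)
    (i : Fin N ⊕ E) : (nodeFactor x y i).eval (Sum.elim x y i) = 0 := by
  rcases i with l | e
  · simp [nodeFactor]
  · simp only [nodeFactor, Sum.elim_inr]
    rcases hy e with h | h <;> simp [h]

/-- If one factor of the annihilating polynomial can be lowered, the moment vector lies on the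
boundary. -/
theorem notMem_interior_of_lower_factor [Fintype E] (t : Fin N ⊕ E ≃ Fin (k + 1)) {y : E → ℝ}
    (hy : ∀ e, y e = 0 ∨ y e = 1) (z : Fin N ⊕ Fin k → ℝ) (j : Fin N ⊕ E) {q : ℝ[X]}
    (hq0 : q ≠ 0) (hq : q.natDegree < (nodeFactor (z ∘ Sum.inl) y j).natDegree)
    (hqn : ∀ u ∈ Set.Icc (0 : ℝ) 1, 0 ≤ q.eval u)
    (hv : fullWeights (z ∘ Sum.inr) (t j) = 0 ∨ q.eval (Sum.elim (z ∘ Sum.inl) y j) = 0 ∨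
      ∃ j' ≠ j, (nodeFactor (z ∘ Sum.inl) y j').eval (Sum.elim (z ∘ Sum.inl) y j) = 0) :
    momentVector t y z ∉ interior (momentSpace (N + k)) := by
  classical
  set F := nodeFactor (z ∘ Sum.inl) y with hF
  have hdeg : (q * ∏ i ∈ {j}ᶜ, F i).natDegree ≤ N + k := by
    rw [natDegree_mul hq0 (Finset.prod_ne_zero_iff.2 fun i _ => nodeFactor_ne_zero _ _ i),
      natDegree_prod _ F fun i _ => nodeFactor_ne_zero _ _ i]
    -- The full product of factors has degree `2N + |E|`, one more than the available moments;
    -- lowering a single factor brings it into range.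
    have h1 : ∑ i, (F i).natDegree = N + k + 1 := by
      have := card_add_card t
      simp only [hF, natDegree_nodeFactor, Fintype.sum_sum_type]
      simp
      omega
    rw [← Finset.sum_add_sum_compl {j}, Finset.sum_singleton] at h1
    omega
  refine notMem_interior_momentSpace (p := q * ∏ i ∈ {j}ᶜ, F i)
    (mul_ne_zero hq0 (Finset.prod_ne_zero_iff.2 fun i _ => nodeFactor_ne_zero _ _ i)) hdeg ?_ ?_
  · intro u hu
    rw [eval_mul, eval_prod]
    exact mul_nonneg (hqn u hu) (Finset.prod_nonneg fun i _ => nodeFactor_nonneg _ _ _ hu)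
  · unfold momentVector
    rw [momentFunctional_sum hdeg _ _ (sum_fullWeights_comp t _)]
    refine Finset.sum_eq_zero fun i _ => ?_
    rw [eval_mul, eval_prod]
    by_cases hij : i = j
    · subst hij
      rcases hv with h | h | ⟨j', hj', h⟩
      · rw [h, zero_mul]
      · rw [h, zero_mul, mul_zero]
      · rw [Finset.prod_eq_zero (i := j') (by simpa using hj') h, mul_zero, mul_zero]
    · rw [Finset.prod_eq_zero (i := i) (by simpa using hij) (nodeFactor_eval_self _ hy i),
        mul_zero, mul_zero]

/-- Each degeneration saves a degree: the factor of a node of zero weight can be dropped, that of a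
free node at an endpoint can be replaced by `X` or `1 - X`, and one of two coinciding free nodes
needs no factor of its own. -/
theorem notMem_interior_of_closedChartDomain_diff [Fintype E] (t : Fin N ⊕ E ≃ Fin (k + 1)) {y : E → ℝ}
    (hy : ∀ e, y e = 0 ∨ y e = 1) {σ : Equiv.Perm (Fin N)} {z : Fin N ⊕ Fin k → ℝ}
    (hz : z ∈ closedChartDomain N k σ) (hz' : z ∉ chartDomain N k σ) :
    momentVector t y z ∉ interior (momentSpace (N + k)) := by
  by_cases hW : ∀ i, 0 < fullWeights (z ∘ Sum.inr) i
  swap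
  · push Not at hW
    obtain ⟨i, hi⟩ := hW
    refine notMem_interior_of_lower_factor t hy z (t.symm i) (q := 1) one_ne_zero ?_ (by simp) ?_
    · rw [natDegree_nodeFactor]
      rcases t.symm i with l | e <;> simp
    · left
      simpa using le_antisymm hi (hz.2.2 i)
  by_cases hx : ∀ l, z (.inl l) ∈ Set.Ioo (0 : ℝ) 1
  swap
  · push Not at hx
    obtain ⟨l, hl⟩ := hx
    have h01 : z (.inl l) = 0 ∨ z (.inl l) = 1 := by
      have := hz.1 l
      by_contra hne
      push Not at hne
      exact hl ⟨lt_of_le_of_ne this.1 hne.1.symm, lt_of_le_of_ne this.2 hne.2⟩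
    rcases h01 with h | h
    · refine notMem_interior_of_lower_factor t hy z (.inl l) (q := X) X_ne_zero ?_ ?_ ?_
      · rw [natDegree_nodeFactor]; simp
      · intro u hu; simpa using hu.1
      · right; left; simp [h]
    · refine notMem_interior_of_lower_factor t hy z (.inl l) (q := 1 - X) one_sub_X_ne_zero ?_ ?_ ?_
      · rw [natDegree_nodeFactor, natDegree_one_sub_X]; simp
      · intro u hu; simpa using hu.2
      · right; left; simp [h]
  have hinj : ¬ Function.Injective fun l => z (.inl (σ l)) := fun hi =>
    hz' ⟨hx, hz.2.1.strictMono_of_injective hi, hW⟩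
  rw [Function.not_injective_iff] at hinj
  obtain ⟨l, l', h, hne⟩ := hinj
  refine notMem_interior_of_lower_factor t hy z (.inl (σ l)) (q := 1) one_ne_zero ?_ (by simp) ?_
  · rw [natDegree_nodeFactor]; simp
  · right; right
    refine ⟨.inl (σ l'), ?_, ?_⟩
    · simpa using hne.symm
    · simp [nodeFactor, h]

theorem vandermondeProd_ne_zero {x : Fin N → ℝ} (hx : Function.Injective x) :
    vandermondeProd x ≠ 0 := by
  refine Finset.prod_ne_zero_iff.2 fun i _ => Finset.prod_ne_zero_iff.2 fun j hj => ?_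
  rw [sub_ne_zero]
  exact fun h => (Finset.mem_Ioi.1 hj).ne' (hx h)

theorem det_jacobianMatrix_ne_zero [Fintype E] [DecidableEq E] (t : Fin N ⊕ E ≃ Fin (k + 1)) {y : E → ℝ}
    (hyi : Function.Injective y) (hy : ∀ e, y e = 0 ∨ y e = 1)
    (hy1 : ∏ i, ∏ i' ∈ {i}ᶜ, |y i - y i'| = 1) {σ : Equiv.Perm (Fin N)} {z : Fin N ⊕ Fin k → ℝ}
    (hz : z ∈ chartDomain N k σ) : (jacobianMatrix t y z).det ≠ 0 := by
  have hinj := nodes_injective hyi hy hz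
  rw [← abs_ne_zero, abs_det_jacobianMatrix t y hy1]
  refine mul_ne_zero (mul_ne_zero ?_ ?_) ?_
  · exact Finset.prod_ne_zero_iff.2 fun l _ => abs_ne_zero.2 (hz.2.2 _).ne'
  · exact pow_ne_zero _ (abs_ne_zero.2 (vandermondeProd_ne_zero
      (hinj.comp Sum.inl_injective)))
  · refine Finset.prod_ne_zero_iff.2 fun l _ => Finset.prod_ne_zero_iff.2 fun e _ =>
      pow_ne_zero _ (abs_ne_zero.2 (sub_ne_zero.2 fun h => ?_))
    have := @hinj (.inl l) (.inr e) h
    simp at this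

/-- Reordering of the coordinates of the chart by the order of the moment. -/
def reorder (N k : ℕ) : (Fin N ⊕ Fin k → ℝ) ≃ₜ (Fin (N + k) → ℝ) :=
  Homeomorph.piCongrLeft (Y := fun _ => ℝ) finSumFinEquiv

theorem reorder_apply (v : Fin N ⊕ Fin k → ℝ) (r : Fin (N + k)) :
    reorder N k v r = v (finSumFinEquiv.symm r) := by
  obtain ⟨r, rfl⟩ := finSumFinEquiv.surjective r
  rw [Equiv.symm_apply_apply]
  exact Equiv.piCongrLeft_apply_apply (fun _ => ℝ) finSumFinEquiv v r

theorem reorder_momentChart [Fintype E] (t : Fin N ⊕ E ≃ Fin (k + 1)) (y : E → ℝ) (z : Fin N ⊕ Fin k → ℝ) :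
    reorder N k (momentChart t y z) = momentVector t y z := by
  ext r
  simp [reorder_apply, momentChart, momentVector, momentOrder]

theorem isOpen_image_momentVector [Fintype E] [DecidableEq E] (t : Fin N ⊕ E ≃ Fin (k + 1)) {y : E → ℝ}
    (hyi : Function.Injective y) (hy : ∀ e, y e = 0 ∨ y e = 1)
    (hy1 : ∏ i, ∏ i' ∈ {i}ᶜ, |y i - y i'| = 1) (σ : Equiv.Perm (Fin N)) :
    IsOpen (momentVector t y '' chartDomain N k σ) := by
  have h1 : momentVector t y = reorder N k ∘ momentChart t y :=
    funext fun z => (reorder_momentChart t y z).symm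
  rw [h1, Set.image_comp]
  refine (reorder N k).isOpenMap _ ?_
  rw [isOpen_iff_mem_nhds]
  rintro _ ⟨z, hz, rfl⟩
  have hd := hasStrictFDerivAt_momentChart t y z
  have hdet := det_jacobianMatrix_ne_zero t hyi hy hy1 hz
  have hsurj : (Matrix.toLin' (jacobianMatrix t y z)).toContinuousLinearMap.range = ⊤ := by
    refine LinearMap.range_eq_top.2 ?_
    intro v
    refine ⟨(jacobianMatrix t y z)⁻¹.mulVec v, ?_⟩
    simp [Matrix.mulVec_mulVec, Matrix.mul_nonsing_inv _ (isUnit_iff_ne_zero.2 hdet)]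
  rw [← hd.map_nhds_eq_of_surj hsurj]
  exact Filter.image_mem_map ((isOpen_chartDomain σ).mem_nhds hz)

/-- Every ordered chart fills the interior of the moment space. -/
theorem image_momentVector [Fintype E] [DecidableEq E] (t : Fin N ⊕ E ≃ Fin (k + 1)) {y : E → ℝ}
    (hyi : Function.Injective y) (hy : ∀ e, y e = 0 ∨ y e = 1)
    (hy1 : ∏ i, ∏ i' ∈ {i}ᶜ, |y i - y i'| = 1) (σ : Equiv.Perm (Fin N)) :
    momentVector t y '' chartDomain N k σ = interior (momentSpace (N + k)) := by
  have hopen := isOpen_image_momentVector t hyi hy hy1 σ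
  have hsub : momentVector t y '' chartDomain N k σ ⊆ interior (momentSpace (N + k)) := by
    refine interior_maximal ?_ hopen
    rintro _ ⟨z, hz, rfl⟩
    exact momentVector_mem_momentSpace t hy (chartDomain_subset_closed σ hz)
  refine hsub.antisymm ?_
  -- A nonempty open subset that is relatively closed in a connected set is everything. A limit of
  -- image points comes from the compact closed chart, and only nondegenerate parameters can reach
  -- the interior.
  refine (convex_momentSpace (N + k)).interior.isPreconnected.subset_of_closure_inter_subset
    hopen ?_ ?_
  · obtain ⟨z, hz⟩ := chartDomain_nonempty (k := k) σ
    exact ⟨_, hsub ⟨z, hz, rfl⟩, ⟨z, hz, rfl⟩⟩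
  · rintro v ⟨hv, hvi⟩
    have hcl : closure (momentVector t y '' chartDomain N k σ)
        ⊆ momentVector t y '' closedChartDomain N k σ :=
      closure_minimal (Set.image_mono (chartDomain_subset_closed σ))
        ((isCompact_closedChartDomain σ).image (continuous_momentVector t y)).isClosed
    obtain ⟨z, hz, rfl⟩ := hcl hv
    refine ⟨z, ?_, rfl⟩
    by_contra hz'
    exact notMem_interior_of_closedChartDomain_diff t hy hz hz' hvi

end Image

/-! ### Transport of the Jacobi and Dirichlet laws to Lebesgue measure. -/

section Law

theorem withDensity_map {α β : Type*} [MeasurableSpace α] [MeasurableSpace β] (μ : Measure α)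
    {f : α → β} (hf : Measurable f) {g : β → ℝ≥0∞} (hg : Measurable g) :
    (μ.map f).withDensity g = (μ.withDensity (g ∘ f)).map f := by
  ext s hs
  rw [withDensity_apply _ hs, Measure.restrict_map hf hs, lintegral_map hg hf,
    Measure.map_apply hf hs, withDensity_apply _ (hf hs)]
  rfl

variable {N k : ℕ} {E : Type*}

/-- The parameters with free nodes in the open interval and positive weights. -/
def openParameters (N k : ℕ) : Set (Fin N ⊕ Fin k → ℝ) :=
  {z | (∀ l, z (.inl l) ∈ Set.Ioo (0 : ℝ) 1) ∧ ∀ i, 0 < fullWeights (z ∘ Sum.inr) i}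

/-- The nodes and weights determined by a parameter. -/
def nodesWeights (z : Fin N ⊕ Fin k → ℝ) : (Fin N → ℝ) × (Fin (k + 1) → ℝ) :=
  (z ∘ Sum.inl, fullWeights (z ∘ Sum.inr))

/-- The density of `dirichlet` with respect to `simplexVolume`. -/
noncomputable def dirichletDensity {n : ℕ} (α : Fin n → ℝ) (w : Fin n → ℝ) : ℝ :=
  Real.Gamma (∑ i, α i) / (∏ i, Real.Gamma (α i)) * ∏ i, w i ^ (α i - 1)

theorem measurable_fullWeights : Measurable (fullWeights (k := k)) := by
  refine measurable_pi_iff.2 fun i => ?_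
  refine Fin.lastCases ?_ (fun j => ?_) i
  · simp only [fullWeights, Fin.snoc_last]; fun_prop
  · simp only [fullWeights, Fin.snoc_castSucc]; fun_prop

theorem measurable_jacobiWeight (β a b : ℝ) : Measurable (jacobiWeight β a b (N := N)) := by
  unfold jacobiWeight vandermondeProd
  fun_prop

theorem measurable_dirichletDensity {n : ℕ} (α : Fin n → ℝ) : Measurable (dirichletDensity α) := by
  unfold dirichletDensity
  fun_prop

theorem fullWeights_pos_iff (w : Fin k → ℝ) :
    (∀ i, 0 < fullWeights w i) ↔ (∀ i, 0 < w i) ∧ ∑ i, w i < 1 := by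
  rw [Fin.forall_fin_succ']
  simp [fullWeights]

theorem isOpen_openParameters : IsOpen (openParameters N k) := by
  simp only [openParameters, Set.ofPred_and, Set.ofPred_forall, Set.mem_Ioo]
  refine IsOpen.inter ?_ ?_
  · exact isOpen_iInter_of_finite fun l => (isOpen_lt continuous_const (continuous_apply _)).inter
      (isOpen_lt (continuous_apply _) continuous_const)
  · exact isOpen_iInter_of_finite fun i => isOpen_lt continuous_const (continuous_fullWeights i)

theorem dirichlet_eq_map (α : Fin (k + 1) → ℝ) :
    dirichlet α = ((volume.restrict {w : Fin k → ℝ | ∀ i, 0 < fullWeights w i}).withDensity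
      fun w => ENNReal.ofReal (dirichletDensity α (fullWeights w))).map fullWeights := by
  have h := withDensity_map
    (volume.restrict {w : Fin k → ℝ | ∀ i, 0 < fullWeights w i}) measurable_fullWeights
    (measurable_dirichletDensity α).ennreal_ofReal
  simp only [fullWeights_pos_iff] at h ⊢
  exact h

/-- The faces of the cube are null; removing them leaves nodes in the open interval, as the charts
require. -/
theorem jacobiUnnormalized_eq (β a b : ℝ) : jacobiUnnormalized β a b N
    = (volume.restrict {x : Fin N → ℝ | ∀ l, x l ∈ Set.Ioo (0 : ℝ) 1}).withDensity
      fun x => ENNReal.ofReal (jacobiWeight β a b x) := by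
  unfold jacobiUnnormalized
  congr 1
  have hs : {x : Fin N → ℝ | ∀ l, x l ∈ Set.Ioo (0 : ℝ) 1}
      = Set.univ.pi fun l => Set.Ioo ((0 : Fin N → ℝ) l) ((1 : Fin N → ℝ) l) := by
    ext x
    simp [Set.mem_pi]
  rw [hs]
  exact Measure.restrict_congr_set (Measure.pi_Ioo_ae_eq_pi_Icc (μ := fun _ : Fin N => (volume : Measure ℝ))
    (s := Set.univ) (f := 0) (g := 1)).symm

theorem jacobi_prod_dirichlet (β a b : ℝ) (α : Fin (k + 1) → ℝ) :
    (jacobi β a b N).prod (dirichlet α) = (jacobiUnnormalized β a b N Set.univ)⁻¹ •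
      ((volume.restrict (openParameters N k)).withDensity fun z =>
        ENNReal.ofReal (jacobiWeight β a b (z ∘ Sum.inl)) *
          ENNReal.ofReal (dirichletDensity α (fullWeights (z ∘ Sum.inr)))).map nodesWeights := by
  have hS : MeasurableSet {w : Fin k → ℝ | ∀ i, 0 < fullWeights w i} := by
    simp only [Set.ofPred_forall]
    exact MeasurableSet.iInter fun i => measurableSet_lt measurable_const
      ((measurable_pi_apply i).comp measurable_fullWeights)
  have hC : MeasurableSet {x : Fin N → ℝ | ∀ l, x l ∈ Set.Ioo (0 : ℝ) 1} := by
    simp only [Set.ofPred_forall]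
    exact MeasurableSet.iInter fun l => (measurable_pi_apply l) measurableSet_Ioo
  have hj : Measurable fun x : Fin N → ℝ => ENNReal.ofReal (jacobiWeight β a b x) :=
    (measurable_jacobiWeight β a b).ennreal_ofReal
  have hd : Measurable fun w : Fin k → ℝ =>
      ENNReal.ofReal (dirichletDensity α (fullWeights w)) :=
    ((measurable_dirichletDensity α).comp measurable_fullWeights).ennreal_ofReal
  rw [jacobi, dirichlet_eq_map, Measure.prod_smul_left]
  congr 1
  nth_rw 1 [jacobiUnnormalized_eq, ← Measure.map_id (μ := Measure.withDensity _ _)]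
  rw [Measure.map_prod_map _ _ measurable_id measurable_fullWeights, prod_withDensity hj hd,
    Measure.prod_restrict]
  have hjd : Measurable fun p : (Fin N → ℝ) × (Fin k → ℝ) =>
      ENNReal.ofReal (jacobiWeight β a b p.1) *
        ENNReal.ofReal (dirichletDensity α (fullWeights p.2)) :=
    (hj.comp measurable_fst).mul (hd.comp measurable_snd)
  have hmp := volume_measurePreserving_sumPiEquivProdPi (fun _ : Fin N ⊕ Fin k => ℝ)
  rw [← Measure.volume_eq_prod, ← hmp.map_eq, Measure.restrict_map hmp.measurable (hC.prod hS),
    withDensity_map _ hmp.measurable hjd,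
    Measure.map_map (measurable_id.prodMap measurable_fullWeights) hmp.measurable]
  rfl

theorem vandermondeProd_eq_zero {x : Fin N → ℝ} (hx : ¬ Function.Injective x) :
    vandermondeProd x = 0 := by
  rw [Function.not_injective_iff] at hx
  obtain ⟨i, j, hij, hne⟩ := hx
  unfold vandermondeProd
  rcases lt_or_gt_of_ne hne with h | h
  · exact Finset.prod_eq_zero (Finset.mem_univ i)
      (Finset.prod_eq_zero (Finset.mem_Ioi.2 h) (by rw [hij, sub_self]))
  · exact Finset.prod_eq_zero (Finset.mem_univ j)
      (Finset.prod_eq_zero (Finset.mem_Ioi.2 h) (by rw [hij, sub_self]))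

theorem pairwise_disjoint_chartDomain :
    Pairwise (Function.onFun Disjoint (chartDomain N k)) := by
  intro σ τ hστ
  rw [Function.onFun, Set.disjoint_left]
  rintro z ⟨-, h1, -⟩ ⟨-, h2, -⟩
  refine hστ ?_
  have hr : Set.range (fun l => z (.inl (σ l))) = Set.range (fun l => z (.inl (τ l))) := by
    rw [show (fun l => z (.inl (σ l))) = (fun l => z (.inl l)) ∘ σ from rfl,
      show (fun l => z (.inl (τ l))) = (fun l => z (.inl l)) ∘ τ from rfl,
      σ.surjective.range_comp, τ.surjective.range_comp]
  have he := (h1.range_inj h2).1 hr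
  have hinj : Function.Injective fun l => z (.inl l) := by
    have := h1.injective.comp σ.symm.injective
    refine fun i j hij => this ?_
    simpa using hij
  ext l
  exact congrArg _ (hinj (congrFun he l))

theorem exists_mem_chartDomain {z : Fin N ⊕ Fin k → ℝ} (hz : z ∈ openParameters N k)
    (hinj : Function.Injective (z ∘ Sum.inl)) : ∃ σ, z ∈ chartDomain N k σ := by
  refine ⟨Tuple.sort (z ∘ Sum.inl), hz.1, ?_, hz.2⟩
  exact (Tuple.monotone_sort (z ∘ Sum.inl)).strictMono_of_injective
    (hinj.comp (Tuple.sort (z ∘ Sum.inl)).injective)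

/-- Parameters with two equal free nodes belong to no ordered chart, but there the Vandermonde
factor makes the density vanish. -/
theorem withDensity_openParameters [Fintype E] [DecidableEq E] (t : Fin N ⊕ E ≃ Fin (k + 1)) {y : E → ℝ}
    (hy1 : ∏ i, ∏ i' ∈ {i}ᶜ, |y i - y i'| = 1) :
    (volume.restrict (openParameters N k)).withDensity
        (fun z => ENNReal.ofReal |(jacobianMatrix t y z).det|)
      = Measure.sum fun σ => (volume.restrict (chartDomain N k σ)).withDensity
        fun z => ENNReal.ofReal |(jacobianMatrix t y z).det| := by
  rw [← withDensity_sum, ← Measure.restrict_iUnion pairwise_disjoint_chartDomain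
    fun σ => (isOpen_chartDomain σ).measurableSet,
    ← withDensity_indicator isOpen_openParameters.measurableSet,
    ← withDensity_indicator (MeasurableSet.iUnion fun σ => (isOpen_chartDomain σ).measurableSet)]
  congr 1
  ext z
  by_cases hz : z ∈ openParameters N k
  · rw [Set.indicator_of_mem hz]
    by_cases hinj : Function.Injective (z ∘ Sum.inl)
    · rw [Set.indicator_of_mem (Set.mem_iUnion.2 (exists_mem_chartDomain hz hinj))]
    · have : |(jacobianMatrix t y z).det| = 0 := by
        rw [abs_det_jacobianMatrix t y hy1, vandermondeProd_eq_zero hinj]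
        simp
      rw [this, ENNReal.ofReal_zero]
      exact (Set.indicator_apply_eq_zero.2 fun _ => by rw [this, ENNReal.ofReal_zero]).symm
  · rw [Set.indicator_of_notMem hz, Set.indicator_of_notMem]
    intro h
    obtain ⟨σ, hσ⟩ := Set.mem_iUnion.1 h
    exact hz ⟨hσ.1, hσ.2.2⟩

/-- This is the change of variables formula for an injective map; the final permutation of
coordinates preserves volume. -/
theorem map_momentVector_chartDomain [Fintype E] [DecidableEq E] (t : Fin N ⊕ E ≃ Fin (k + 1)) {y : E → ℝ}
    (hyi : Function.Injective y) (hy : ∀ e, y e = 0 ∨ y e = 1)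
    (hy1 : ∏ i, ∏ i' ∈ {i}ᶜ, |y i - y i'| = 1) (σ : Equiv.Perm (Fin N)) :
    ((volume.restrict (chartDomain N k σ)).withDensity
      fun z => ENNReal.ofReal |(jacobianMatrix t y z).det|).map (momentVector t y)
      = volume.restrict (interior (momentSpace (N + k))) := by
  have h1 : momentVector t y = reorder N k ∘ momentChart t y :=
    funext fun z => (reorder_momentChart t y z).symm
  have hc : Continuous (momentChart t y) :=
    continuous_iff_continuousAt.2 fun z => (hasStrictFDerivAt_momentChart t y z).continuousAt
  have hinj : Set.InjOn (momentChart t y) (chartDomain N k σ) := by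
    intro z hz z' hz' h
    refine injOn_momentVector t hyi hy σ hz hz' ?_
    rw [h1, Function.comp_apply, Function.comp_apply, h]
  have harea := map_withDensity_abs_det_fderiv_eq_addHaar volume
    (isOpen_chartDomain σ).measurableSet.nullMeasurableSet
    (fun z _ => (hasStrictFDerivAt_momentChart t y z).hasFDerivAt.hasFDerivWithinAt) hinj
  have hdet : ∀ z, ((Matrix.toLin' (jacobianMatrix t y z)).toContinuousLinearMap).det
      = (jacobianMatrix t y z).det := fun z => by
    rw [ContinuousLinearMap.det, LinearMap.coe_toContinuousLinearMap, LinearMap.det_toLin']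
  simp only [hdet] at harea
  have hmp : MeasurePreserving (reorder N k) volume volume :=
    volume_measurePreserving_piCongrLeft (fun _ => ℝ) finSumFinEquiv
  rw [← image_momentVector t hyi hy hy1 σ, h1,
    ← Measure.map_map (reorder N k).continuous.measurable hc.measurable, harea, Set.image_comp]
  exact (hmp.restrict_image_emb (reorder N k).measurableEmbedding _).map_eq

theorem density_eq [Fintype E] [DecidableEq E] (t : Fin N ⊕ E ≃ Fin (k + 1)) {y : E → ℝ}
    (hy1 : ∏ i, ∏ i' ∈ {i}ᶜ, |y i - y i'| = 1) {a b : ℝ} {α : Fin (k + 1) → ℝ}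
    (hab : ∀ u ∈ Set.Ioo (0 : ℝ) 1, u ^ (b - 1) * (1 - u) ^ (a - 1) = ∏ e, |u - y e| ^ 2)
    (hα2 : ∀ l, α (t (.inl l)) = 2) (hα1 : ∀ e, α (t (.inr e)) = 1)
    {z : Fin N ⊕ Fin k → ℝ} (hz : z ∈ openParameters N k) :
    ENNReal.ofReal (jacobiWeight 4 a b (z ∘ Sum.inl)) *
        ENNReal.ofReal (dirichletDensity α (fullWeights (z ∘ Sum.inr)))
      = ENNReal.ofReal (Real.Gamma (∑ i, α i) / (∏ i, Real.Gamma (α i))) *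
        ENNReal.ofReal |(jacobianMatrix t y z).det| := by
  have hα0 : ∀ i, 0 ≤ α i := by
    intro i
    obtain ⟨l | e, rfl⟩ := t.surjective i
    · rw [hα2]; norm_num
    · rw [hα1]; norm_num
  have hG : 0 ≤ Real.Gamma (∑ i, α i) / (∏ i, Real.Gamma (α i)) :=
    div_nonneg (Real.Gamma_nonneg_of_nonneg (Finset.sum_nonneg fun i _ => hα0 i))
      (Finset.prod_nonneg fun i _ => Real.Gamma_nonneg_of_nonneg (hα0 i))
  have hjw : jacobiWeight 4 a b (z ∘ Sum.inl)
      = |vandermondeProd (z ∘ Sum.inl)| ^ 4 * ∏ l, ∏ e, |z (.inl l) - y e| ^ 2 := by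
    unfold jacobiWeight
    congr 1
    · exact_mod_cast Real.rpow_natCast |vandermondeProd (z ∘ Sum.inl)| 4
    · exact Finset.prod_congr rfl fun l _ => hab _ (hz.1 l)
  have hdd : ∏ i, fullWeights (z ∘ Sum.inr) i ^ (α i - 1)
      = ∏ l, |fullWeights (z ∘ Sum.inr) (t (.inl l))| := by
    rw [← Equiv.prod_comp t, Fintype.prod_sum_type]
    simp only [hα2, hα1, sub_self, Real.rpow_zero, Finset.prod_const_one, mul_one]
    refine Finset.prod_congr rfl fun l _ => ?_
    rw [abs_of_pos (hz.2 _)]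
    norm_num
  rw [← ENNReal.ofReal_mul hG, ← ENNReal.ofReal_mul (by rw [hjw]; positivity),
    abs_det_jacobianMatrix t y hy1, dirichletDensity, hdd, hjw]
  congr 1
  ring

/-- The moment vector of the atomic measure with nodes `p.1` and `y` and weights `p.2`. -/
noncomputable def atomicMoments [Fintype E] (n : ℕ) (t : Fin N ⊕ E ≃ Fin (k + 1)) (y : E → ℝ)
    (p : (Fin N → ℝ) × (Fin (k + 1) → ℝ)) : Fin n → ℝ :=
  moments n (∑ l, atom (p.2 (t (.inl l))) (p.1 l) + ∑ e, atom (p.2 (t (.inr e))) (y e))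

theorem atomicMoments_eq [Fintype E] {n : ℕ} (t : Fin N ⊕ E ≃ Fin (k + 1)) (y : E → ℝ)
    (p : (Fin N → ℝ) × (Fin (k + 1) → ℝ)) :
    atomicMoments n t y p
      = fun r : Fin n => ∑ i, max (p.2 (t i)) 0 * Sum.elim p.1 y i ^ ((r : ℕ) + 1) := by
  rw [← moments_sum_atom, Fintype.sum_sum_type]
  rfl

theorem measurable_atomicMoments [Fintype E] {n : ℕ} (t : Fin N ⊕ E ≃ Fin (k + 1)) (y : E → ℝ) :
    Measurable (atomicMoments n t y) := by
  rw [funext (atomicMoments_eq t y)]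
  refine measurable_pi_iff.2 fun r => Finset.measurable_sum _ fun i _ => ?_
  refine Measurable.mul (by fun_prop) (Measurable.pow_const ?_ _)
  rcases i with l | e
  · exact (measurable_pi_apply l).comp measurable_fst
  · exact measurable_const

/-- The pushforward of the law of nodes and weights is a multiple of Lebesgue measure on the
moment space. -/
theorem exists_map_eq_smul [Fintype E] [DecidableEq E] (t : Fin N ⊕ E ≃ Fin (k + 1)) {y : E → ℝ}
    (hyi : Function.Injective y) (hy : ∀ e, y e = 0 ∨ y e = 1)
    (hy1 : ∏ i, ∏ i' ∈ {i}ᶜ, |y i - y i'| = 1) {a b : ℝ} {α : Fin (k + 1) → ℝ}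
    (hab : ∀ u ∈ Set.Ioo (0 : ℝ) 1, u ^ (b - 1) * (1 - u) ^ (a - 1) = ∏ e, |u - y e| ^ 2)
    (hα2 : ∀ l, α (t (.inl l)) = 2) (hα1 : ∀ e, α (t (.inr e)) = 1) :
    ∃ c : ℝ≥0∞, ((jacobi 4 a b N).prod (dirichlet α)).map (atomicMoments (N + k) t y)
      = c • volume.restrict (momentSpace (N + k)) := by
  set G := ENNReal.ofReal (Real.Gamma (∑ i, α i) / (∏ i, Real.Gamma (α i)))
  set μ := (volume.restrict (openParameters N k)).withDensity
    (fun z => ENNReal.ofReal |(jacobianMatrix t y z).det|) with hμ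
  have hpr : Measurable (nodesWeights (N := N) (k := k)) :=
    Measurable.prodMk (by fun_prop) (measurable_fullWeights.comp (by fun_prop))
  have h1 : (volume.restrict (openParameters N k)).withDensity (fun z =>
        ENNReal.ofReal (jacobiWeight 4 a b (z ∘ Sum.inl)) *
          ENNReal.ofReal (dirichletDensity α (fullWeights (z ∘ Sum.inr)))) = G • μ := by
    rw [hμ, ← withDensity_smul' _ _ ENNReal.ofReal_ne_top]
    refine withDensity_congr_ae ?_
    filter_upwards [ae_restrict_mem isOpen_openParameters.measurableSet] with z hz
    exact density_eq t hy1 hab hα2 hα1 hz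
  have h2 : μ.map (atomicMoments (N + k) t y ∘ nodesWeights) = μ.map (momentVector t y) := by
    refine Measure.map_congr ?_
    have hae : ∀ᵐ z ∂μ, z ∈ openParameters N k :=
      (withDensity_absolutelyContinuous _ _).ae_le
        (ae_restrict_mem isOpen_openParameters.measurableSet)
    filter_upwards [hae] with z hz
    simp only [Function.comp_apply, atomicMoments_eq, nodesWeights,
      max_eq_left (hz.2 _).le]
    rfl
  have h3 : μ.map (momentVector t y)
      = Measure.sum fun _ : Equiv.Perm (Fin N) => volume.restrict (momentSpace (N + k)) := by
    rw [hμ, withDensity_openParameters t hy1,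
      Measure.map_sum (continuous_momentVector t y).measurable.aemeasurable]
    simp only [map_momentVector_chartDomain t hyi hy hy1]
    -- The frontier of a convex set is null, so the interior may be replaced by the whole moment
    -- space.
    rw [Measure.restrict_congr_set (interior_ae_eq_of_null_frontier
      ((convex_momentSpace (N + k)).addHaar_frontier volume))]
  -- The factors are the Jacobi normalization, the Dirichlet constant, and the number `N!` of
  -- orderings.
  refine ⟨(jacobiUnnormalized 4 a b N Set.univ)⁻¹ * (G * Fintype.card (Equiv.Perm (Fin N))), ?_⟩
  rw [jacobi_prod_dirichlet, h1, Measure.map_smul,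
    Measure.map_map (measurable_atomicMoments t y) hpr, Measure.map_smul, h2, h3, mul_smul, mul_smul, Measure.sum_fintype]
  simp [Nat.cast_smul_eq_nsmul]

theorem hasLaw_uniformMoments [Fintype E] [DecidableEq E] {Ω : Type*} [MeasurableSpace Ω]
    {P : Measure Ω} [IsProbabilityMeasure P] {n : ℕ} (hn : n = N + k) (t : Fin N ⊕ E ≃ Fin (k + 1)) {y : E → ℝ}
    (hyi : Function.Injective y) (hy : ∀ e, y e = 0 ∨ y e = 1)
    (hy1 : ∏ i, ∏ i' ∈ {i}ᶜ, |y i - y i'| = 1) {a b : ℝ} {α : Fin (k + 1) → ℝ}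
    (hab : ∀ u ∈ Set.Ioo (0 : ℝ) 1, u ^ (b - 1) * (1 - u) ^ (a - 1) = ∏ e, |u - y e| ^ 2)
    (hα2 : ∀ l, α (t (.inl l)) = 2) (hα1 : ∀ e, α (t (.inr e)) = 1)
    {X : Ω → Fin N → ℝ} {W : Ω → Fin (k + 1) → ℝ}
    (h : HasLaw (fun ω => (X ω, W ω)) ((jacobi 4 a b N).prod (dirichlet α)) P) :
    HasLaw (fun ω => moments n
      (∑ l, atom (W ω (t (.inl l))) (X ω l) + ∑ e, atom (W ω (t (.inr e))) (y e)))
      (uniformMoments n) P := by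
  subst hn
  have hm := measurable_atomicMoments (n := N + k) t y
  have hae : AEMeasurable (fun ω => atomicMoments (N + k) t y (X ω, W ω)) P :=
    hm.comp_aemeasurable h.aemeasurable
  refine ⟨hae, ?_⟩
  obtain ⟨c, hc⟩ := exists_map_eq_smul t hyi hy hy1 hab hα2 hα1
  have hmap : P.map (fun ω => atomicMoments (N + k) t y (X ω, W ω))
      = c • volume.restrict (momentSpace (N + k)) := by
    rw [← hc, ← h.map_eq, AEMeasurable.map_map_of_aemeasurable hm.aemeasurable h.aemeasurable]
    rfl
  -- The pushforward of `P` has mass one, which forces `c` to be the inverse volume; no Selberg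
  -- integral is evaluated.
  have hprob : c * volume (momentSpace (N + k)) = 1 := by
    have := (Measure.isProbabilityMeasure_map hae).measure_univ
    rw [hmap] at this
    simpa using this
  change P.map (fun ω => atomicMoments (N + k) t y (X ω, W ω)) = _
  rw [hmap, uniformMoments, ProbabilityTheory.cond, ENNReal.eq_inv_of_mul_eq_one_left hprob]

end Law

end RandomMoments

/-! ### The four choices of endpoint atoms. -/

open RandomMoments in
theorem theorem4p8 {Ω : Type*} [MeasurableSpace Ω] (P : Measure Ω) [IsProbabilityMeasure P]
    (N : ℕ) (hN : 1 ≤ N) :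
    -- atoms `x₁, …, x_N`
    (∀ (X : Ω → Fin N → ℝ) (W : Ω → Fin N → ℝ),
      HasLaw (fun ω => (X ω, W ω))
        ((jacobi 4 1 1 N).prod (dirichlet fun _ : Fin N => 2)) P →
      HasLaw (fun ω => moments (2 * N - 1) (∑ k : Fin N, atom (W ω k) (X ω k)))
        (uniformMoments (2 * N - 1)) P) ∧
    -- atoms `0, x₁, …, x_N`
    (∀ (X : Ω → Fin N → ℝ) (W : Ω → Fin (N + 1) → ℝ),
      HasLaw (fun ω => (X ω, W ω))
        ((jacobi 4 1 3 N).prod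
          (dirichlet fun i : Fin (N + 1) => if i = 0 then 1 else 2)) P →
      HasLaw (fun ω => moments (2 * N)
          (atom (W ω 0) 0 + ∑ k : Fin N, atom (W ω k.succ) (X ω k)))
        (uniformMoments (2 * N)) P) ∧
    -- atoms `0, x₁, …, x_{N-1}, 1`
    (∀ (X : Ω → Fin (N - 1) → ℝ) (W : Ω → Fin (N + 1) → ℝ),
      HasLaw (fun ω => (X ω, W ω))
        ((jacobi 4 3 3 (N - 1)).prod
          (dirichlet fun i : Fin (N + 1) => if i = 0 ∨ i = Fin.last N then 1 else 2)) P →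
      HasLaw (fun ω => moments (2 * N - 1)
          (atom (W ω 0) 0
            + ∑ k : Fin (N - 1), atom (W ω ⟨(k : ℕ) + 1, by omega⟩) (X ω k)
            + atom (W ω (Fin.last N)) 1))
        (uniformMoments (2 * N - 1)) P) ∧
    -- atoms `x₁, …, x_N, 1`
    (∀ (X : Ω → Fin N → ℝ) (W : Ω → Fin (N + 1) → ℝ),
      HasLaw (fun ω => (X ω, W ω))
        ((jacobi 4 3 1 N).prod
          (dirichlet fun i : Fin (N + 1) => if i = Fin.last N then 1 else 2)) P →
      HasLaw (fun ω => moments (2 * N)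
          (∑ k : Fin N, atom (W ω k.castSucc) (X ω k) + atom (W ω (Fin.last N)) 1))
        (uniformMoments (2 * N)) P) := by
  refine ⟨?_, ?_, ?_, ?_⟩
  · intro X W h
    -- Without endpoint atoms all `N` weights belong to free nodes, so `N - 1` of them are free and
    -- `n = N + (N - 1)`.
    obtain ⟨k, rfl⟩ : ∃ k, N = k + 1 := ⟨N - 1, by omega⟩
    have := hasLaw_uniformMoments (n := 2 * (k + 1) - 1) (by omega)
      (Equiv.sumEmpty (Fin (k + 1)) Empty) (y := Empty.elim) (fun i => i.elim) (fun i => i.elim)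
      (by simp) (by intro u _; simp) (fun _ => rfl) (fun i => i.elim) h
    simpa using this
  · intro X W h
    have hb : Function.Bijective (Sum.elim Fin.succ (fun _ => 0) : Fin N ⊕ Unit → Fin (N + 1)) := by
      refine (Fintype.bijective_iff_injective_and_card _).2 ⟨?_, by simp⟩
      refine Function.Injective.sumElim (Fin.succ_injective N)
        (Function.injective_of_subsingleton _) fun l _ => Fin.succ_ne_zero l
    have := hasLaw_uniformMoments (n := 2 * N) (by omega) (Equiv.ofBijective _ hb)
      (y := fun _ => 0) (Function.injective_of_subsingleton _) (by simp)
      (by simp [show ({()}ᶜ : Finset Unit) = ∅ from rfl])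
      (by
        intro u hu
        norm_num) (fun l => by simp) (fun i => by simp) h
    simpa [add_comm] using this
  · intro X W h
    obtain ⟨M, rfl⟩ : ∃ M, N = M + 1 := ⟨N - 1, by omega⟩
    have hb : Function.Bijective (Sum.elim (fun l => l.succ.castSucc)
        (fun c => if c then Fin.last (M + 1) else 0) : Fin M ⊕ Bool → Fin (M + 1 + 1)) := by
      refine (Fintype.bijective_iff_injective_and_card _).2 ⟨?_, by simp⟩
      refine Function.Injective.sumElim
        ((Fin.castSucc_injective _).comp (Fin.succ_injective M)) ?_ ?_
      · intro c d
        cases c <;> cases d <;> simp [Fin.ext_iff]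
      · intro l c
        have := l.isLt
        cases c <;> simp [Fin.ext_iff]
        omega
    have := hasLaw_uniformMoments (n := 2 * (M + 1) - 1) (by omega) (Equiv.ofBijective _ hb)
      (y := fun c => if c then 1 else 0) (fun c d => by cases c <;> cases d <;> simp)
      (by simp) (by simp [show ({true}ᶜ : Finset Bool) = {false} from rfl,
        show ({false}ᶜ : Finset Bool) = {true} from rfl])
      (by
        intro u hu
        norm_num [abs_sub_comm u]
        ring) (fun l => by
          have := l.isLt
          simp [Fin.ext_iff]
          omega) (fun c => by cases c <;> simp) h
    simp only [Equiv.ofBijective_apply, Sum.elim_inl, Sum.elim_inr, Fintype.sum_bool] at this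
    -- The sum over `Bool` lists `true` first, so the atom at `1` precedes the atom at `0`.
    have hperm : ∀ ω, atom (W ω 0) 0
        + ∑ l : Fin M, atom (W ω ⟨(l : ℕ) + 1, by omega⟩) (X ω l) + atom (W ω (Fin.last (M + 1))) 1
        = ∑ l : Fin M, atom (W ω l.succ.castSucc) (X ω l)
          + (atom (W ω (Fin.last (M + 1))) 1 + atom (W ω 0) 0) := by
      intro ω
      rw [add_comm (atom (W ω 0) 0), add_assoc, add_comm (atom (W ω 0) 0)]
      rfl
    refine this.congr (Filter.Eventually.of_forall fun ω => ?_)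
    exact (congrArg (moments _) (hperm ω)).trans (by simp)
  · intro X W h
    have hb : Function.Bijective
        (Sum.elim Fin.castSucc (fun _ => Fin.last N) : Fin N ⊕ Unit → Fin (N + 1)) := by
      refine (Fintype.bijective_iff_injective_and_card _).2 ⟨?_, by simp⟩
      refine Function.Injective.sumElim (Fin.castSucc_injective N)
        (Function.injective_of_subsingleton _) fun l _ => (Fin.castSucc_lt_last l).ne
    have := hasLaw_uniformMoments (n := 2 * N) (by omega) (Equiv.ofBijective _ hb)
      (y := fun _ => 1) (Function.injective_of_subsingleton _) (by simp)
      (by simp [show ({()}ᶜ : Finset Unit) = ∅ from rfl])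
      (by
        intro u hu
        norm_num [abs_sub_comm u]) (fun l => by simp [(Fin.castSucc_lt_last l).ne]) (fun i => by simp) h
    simpa using this
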